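/- \textbf{Setting.} Decompose the parameter plane $\mathbb{R}^2$ into a locally finite family of disjoint non-empty connected open sets (the \emph{facets}) whose closures cover $\mathbb{R}^2$. Assume that, outside a locally finite set of \emph{vertices}, the complement of the facets consists of smooth regular curves (the \emph{edges}, straight or curved), each side of which locally lies in a facet. A mapping is \emph{piecewise $C^n$} if its restriction to each facet extends to a $C^n$ mapping on $\mathbb{R}^2$; it need not be continuous across edges. Let $R=[a_1,b_1]\times[a_2,b_2]$ with $a_1<b_1$ and $a_2<b_2$. A mapping on $\mathbb{R}^2$ is \emph{periodic} if it is invariant under translation by $(b_1-a_1,0)$ and by $(0,b_2-a_2)$. Let $\mathbf x:\mathbb{R}^2\to\mathbb{R}^3$ be a periodic surface: $\mathbf x$ is continuous and piecewise $C^\infty$, its partial derivatives $\mathbf x_u,\mathbf x_v$ are linearly independent wherever they exist, and $\mathbf x(u,v)=u\mathbf p_1+v\mathbf p_2+\tilde{\mathbf x}(u,v)$ with $\mathbf p_1,\mathbf p_2\in\mathbb{R}^3$ linearly independent and $\tilde{\mathbf x}$ periodic. A piecewise $C^1$ field $\mathbf w:\mathbb{R}^2\to\mathbb{R}^3$ (relative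 to the same decomposition) is \emph{admissible} if $\mathbf w\wedge \mathrm d\mathbf x/\mathrm ds$ is single-valued along the edges. That is, for every smooth $s\mapsto\gamma(s)=(u(s),v(s))$ running in an edge, the limits $\mathbf w^{\pm}$ of $\mathbf w$ at $\gamma(s)$ from the facets adjacent to the edge satisfy $\mathbf w^+\wedge \frac{\mathrm d}{\mathrm ds}\mathbf x(\gamma(s))=\mathbf w^-\wedge \frac{\mathrm d}{\mathrm ds}\mathbf x(\gamma(s))$. (This is automatic along edges across which $\mathbf w$ is continuous.) Set $$\mathcal D_{\mathbf x}\mathbf w=\mathbf w_v\wedge\mathbf x_u-\mathbf w_u\wedge\mathbf x_v ,$$ which is defined almost everywhere. \textbf{Lemma.} For all periodic admissible fields $\boldsymbol\omega$ and $\mathbf w$, the functions $\langle\boldsymbol\omega,\mathcal D_{\mathbf x}\mathbf w\rangle$ and $\langle\mathbf w,\mathcal D_{\mathbf x}\boldsymbol\omega\rangle$ are integrable over $R$, and $$\frac{1}{\operatorname{Area}(R)}\int_R\langle\boldsymbol\omega,\mathcal D_{\mathbf x}\mathbf w\rangle\,\mathrm du\,\mathrm dv=\frac{1}{\operatorname{Area}(R)}\int_R\langle\mathbf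 w,\mathcal D_{\mathbf x}\boldsymbol\omega\rangle\,\mathrm du\,\mathrm dv .$$ -/

import Mathlib

open scoped Matrix Topology
open MeasureTheory

namespace PeriodicShell

open scoped ContDiff

/-- The parameter plane, with coordinates `(u, v)`. -/
abbrev Plane : Type := ℝ × ℝ

/-- The ambient space; the scalar product is `⬝ᵥ` and the vector product is `⨯₃`. -/
abbrev Space : Type := Fin 3 → ℝ

/-- The partial derivative `∂f/∂u`. -/
noncomputable def partialU (f : Plane → Space) (p : Plane) : Space :=
  lineDeriv ℝ f p (1, 0)

/-- The partial derivative `∂f/∂v`. -/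
noncomputable def partialV (f : Plane → Space) (p : Plane) : Space :=
  lineDeriv ℝ f p (0, 1)

/-- The Darboux operator `D_x w = w_v ∧ x_u - w_u ∧ x_v`. -/
noncomputable def darboux (x w : Plane → Space) (p : Plane) : Space :=
  partialV w p ⨯₃ partialU x p - partialU w p ⨯₃ partialV x p

/-- A decomposition of the parameter plane into facets: a locally finite family of disjoint
non-empty connected open sets whose closures cover the plane and which, away from a locally
finite set of vertices, are bordered by smooth regular curves (straight or curved). -/
structure FacetDecomposition where
  /-- The (open) facets. -/
  facets : Set (Set Plane)
  /-- The vertices, where arbitrarily many edges may meet, in any way. -/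
  vertices : Set Plane
  isOpen_facet : ∀ P ∈ facets, IsOpen P
  isConnected_facet : ∀ P ∈ facets, IsConnected P
  disjoint_facets : ∀ P ∈ facets, ∀ Q ∈ facets, P ≠ Q → Disjoint P Q
  locallyFinite_facets : ∀ p : Plane, ∃ U ∈ 𝓝 p, {P ∈ facets | (P ∩ U).Nonempty}.Finite
  cover : ∀ p : Plane, ∃ P ∈ facets, p ∈ closure P
  locallyFinite_vertices : ∀ p : Plane, ∃ U ∈ 𝓝 p, (vertices ∩ U).Finite
  /-- Near a point `p` of an edge, the points outside the facets form the zero set of a smooth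
  function `φ` with non-zero differential, each side of which lies in a facet. -/
  smooth_edge : ∀ p : Plane, p ∉ vertices → (∀ P ∈ facets, p ∉ P) →
    ∃ P ∈ facets, ∃ Q ∈ facets, ∃ φ : Plane → ℝ,
      ContDiffAt ℝ ∞ φ p ∧ φ p = 0 ∧ fderiv ℝ φ p ≠ 0 ∧
      ∀ᶠ q in 𝓝 p, (φ q < 0 → q ∈ P) ∧ (0 < φ q → q ∈ Q) ∧
        (φ q = 0 → ∀ S ∈ facets, q ∉ S)

namespace FacetDecomposition

/-- The union of the open edges: the points that are neither in a facet nor a vertex. -/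
def edges (N : FacetDecomposition) : Set Plane :=
  {p | p ∉ N.vertices ∧ ∀ P ∈ N.facets, p ∉ P}

/-- `f` is of class `C^n` on each closed facet: its restriction to the open facet extends to a
`C^n` mapping. No continuity across the edges is required, and the values of `f` at the points
of the edges play no role. -/
def PiecewiseContDiff (N : FacetDecomposition) (n : WithTop ℕ∞) (f : Plane → Space) : Prop :=
  ∀ P ∈ N.facets, ∃ g : Plane → Space, ContDiff ℝ n g ∧ Set.EqOn f g P

end FacetDecomposition

/-- A surface parametrized over the whole plane: a continuous, piecewise smooth mapping whose
partial derivatives are linearly independent wherever they exist. -/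
structure IsSurface (N : FacetDecomposition) (x : Plane → Space) : Prop where
  continuous : Continuous x
  piecewise_smooth : N.PiecewiseContDiff ∞ x
  immersive : ∀ p : Plane, LineDifferentiableAt ℝ x p (1, 0) →
    LineDifferentiableAt ℝ x p (0, 1) → LinearIndependent ℝ ![partialU x p, partialV x p]

/-- A rectangle `[a₁, b₁] × [a₂, b₂]` with non-empty interior. -/
structure UnitCell where
  (a₁ b₁ a₂ b₂ : ℝ)
  lt₁ : a₁ < b₁
  lt₂ : a₂ < b₂

namespace UnitCell

/-- The unit cell as a set of parameters. -/
def toSet (R : UnitCell) : Set Plane := Set.Icc R.a₁ R.b₁ ×ˢ Set.Icc R.a₂ R.b₂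

/-- `f` is periodic with unit cell `R`. -/
def IsPeriodic (R : UnitCell) (f : Plane → Space) : Prop :=
  Function.Periodic f (R.b₁ - R.a₁, 0) ∧ Function.Periodic f (0, R.b₂ - R.a₂)

end UnitCell

/-- An `R`-periodic surface: a surface of the form `x(u, v) = u p₁ + v p₂ + y(u, v)` with `p₁`,
`p₂` linearly independent and `y` periodic with unit cell `R`. -/
structure IsPeriodicSurface (R : UnitCell) (N : FacetDecomposition) (x : Plane → Space) :
    Prop where
  isSurface : IsSurface N x
  periodic : ∃ (p₁ p₂ : Space) (y : Plane → Space), LinearIndependent ℝ ![p₁, p₂] ∧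
    R.IsPeriodic y ∧ ∀ p : Plane, x p = p.1 • p₁ + p.2 • p₂ + y p

/-- `w` is an admissible field of infinitesimal rotations of `x`: it is piecewise differentiable
and `w ∧ dx/ds` is single-valued along every smooth curve `s ↦ γ s` that runs in an edge, that
is, the limits `α` and `β` of `w` from any two facets adjacent to the edge at `γ s` satisfy
`α ∧ dx/ds = β ∧ dx/ds`. (This is automatic along edges across which `w` is continuous.) -/
structure IsAdmissible (N : FacetDecomposition) (x w : Plane → Space) : Prop where
  piecewise_differentiable : N.PiecewiseContDiff 1 w
  single_valued : ∀ (γ : ℝ → Plane) (s : ℝ), ContDiffAt ℝ ∞ γ s →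
    (∀ᶠ t in 𝓝 s, γ t ∈ N.edges) →
    ∀ P ∈ N.facets, ∀ Q ∈ N.facets, γ s ∈ closure P → γ s ∈ closure Q →
    ∀ α β : Space, Filter.Tendsto w (𝓝[P] γ s) (𝓝 α) → Filter.Tendsto w (𝓝[Q] γ s) (𝓝 β) →
      α ⨯₃ deriv (fun t => x (γ t)) s = β ⨯₃ deriv (fun t => x (γ t)) s

end PeriodicShell

/-! The difference of the two integrands is, up to sign, the exterior derivative of the periodic
1-form `η = [ω, w, dx]`: with `A = [ω, w, x_u]` and `B = [ω, w, x_v]` it equals `A_v - B_u` inside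
each facet, because the terms with `x_uv` cancel (`curl_tripleProduct`). The curl of a periodic form
has mean value zero over a cell, so it remains to exclude singular contributions from edges and
vertices.

Since facet boundaries may be wild at the vertices, Stokes' theorem is not applied facet by facet.
The equation is instead read in the sense of distributions (`IsWeakCurl`), a local property. Across
an edge with tangent `T = dx/ds`, admissibility fixes `ω ∧ T` and `w ∧ T`, hence also `[ω, w, T]`;
the tangential part of `η` does not jump, and the edge carries no singular curl
(`isWeakCurl_indicator_neg`, `exists_isWeakCurl_of_mem_edges`). At a vertex `η` is bounded, and
points are removable for bounded forms in the plane (`IsWeakCurl.of_diff_singleton`). Testing the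
resulting global equation with a bump whose period translates add up to 1 gives the lemma
(`setIntegral_eq_zero_of_isWeakCurl`). -/

namespace PeriodicShell

open Filter Set

/-! ### Weak curls and their locality -/

/-- The equation `f = ∂A/∂v - ∂B/∂u` holds on `U` in the sense of distributions. -/
def IsWeakCurl (A B f : Plane → ℝ) (U : Set Plane) : Prop :=
  ∀ θ : Plane → ℝ, ContDiff ℝ 1 θ → HasCompactSupport θ → tsupport θ ⊆ U →
    ∫ q, (θ q * f q + fderiv ℝ θ q (0, 1) * A q - fderiv ℝ θ q (1, 0) * B q) = 0

theorem continuous_fderiv_apply_const {g : Plane → ℝ} (hg : ContDiff ℝ 1 g) (e : Plane) :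
    Continuous fun q => fderiv ℝ g q e :=
  (hg.continuous_fderiv one_ne_zero).clm_apply continuous_const

theorem hasCompactSupport_fderiv_apply_const {g : Plane → ℝ} (hg : HasCompactSupport g)
    (e : Plane) : HasCompactSupport fun q => fderiv ℝ g q e :=
  (hg.fderiv ℝ).comp_left (g := fun L : Plane →L[ℝ] ℝ => L e) rfl

theorem fderiv_apply_eq_zero_of_notMem_tsupport {g : Plane → ℝ} {q : Plane}
    (hq : q ∉ tsupport g) (e : Plane) : fderiv ℝ g q e = 0 := by
  have : fderiv ℝ g q = 0 := by
    by_contra h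
    exact hq (support_fderiv_subset ℝ h)
  simp [this]

/-- Integration by parts against a cutoff `χ` that equals 1 near the support of `g`: the derivative
of `χ` vanishes wherever `g` does not. -/
theorem integral_fderiv_apply_eq_zero {g : Plane → ℝ} (hg : ContDiff ℝ 1 g)
    (hgc : HasCompactSupport g) (e : Plane) : ∫ q, fderiv ℝ g q e = 0 := by
  have hg' : Integrable (fun q => fderiv ℝ g q e) :=
    (continuous_fderiv_apply_const hg e).integrable_of_hasCompactSupport
      (hasCompactSupport_fderiv_apply_const hgc e)
  obtain ⟨χ, hχ1, hχ, hχc⟩ : ∃ χ : Plane → ℝ, (∀ q ∈ tsupport g, χ =ᶠ[𝓝 q] 1) ∧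
      ContDiff ℝ 1 χ ∧ HasCompactSupport χ := by
    obtain ⟨r, hr, hgr⟩ : ∃ r : ℝ, 0 < r ∧ tsupport g ⊆ Metric.ball 0 r := by
      obtain ⟨r, hr⟩ := hgc.isCompact.isBounded.subset_ball 0
      exact ⟨max r 1, by positivity, hr.trans (Metric.ball_subset_ball (le_max_left _ _))⟩
    let b : ContDiffBump (0 : Plane) := ⟨r, r + 1, hr, by linarith⟩
    refine ⟨b, fun q hq => ?_, b.contDiff, b.hasCompactSupport⟩
    exact b.eventuallyEq_one_of_mem_ball (hgr hq)
  have h := integral_mul_fderiv_eq_neg_fderiv_mul_of_integrable (μ := volume) (f := χ) (g := g)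
    (v := e) ?_ ?_ ?_ (fun q _ => hχ.differentiable one_ne_zero q)
    (fun q _ => hg.differentiable one_ne_zero q)
  · have h1 : ∀ q, χ q * fderiv ℝ g q e = fderiv ℝ g q e := fun q => by
      by_cases hq : q ∈ tsupport g
      · simp [(hχ1 q hq).self_of_nhds]
      · simp [fderiv_apply_eq_zero_of_notMem_tsupport hq]
    have h2 : ∀ q, fderiv ℝ χ q e * g q = 0 := fun q => by
      by_cases hq : q ∈ tsupport g
      · rw [(hχ1 q hq).fderiv_eq]
        simp [Pi.one_def]
      · simp [image_eq_zero_of_notMem_tsupport hq]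
    simpa [h1, h2] using h
  · exact ((continuous_fderiv_apply_const hχ e).mul hg.continuous).integrable_of_hasCompactSupport
      hgc.mul_left
  · exact (hχ.continuous.mul
      (continuous_fderiv_apply_const hg e)).integrable_of_hasCompactSupport hχc.mul_right
  · exact (hχ.continuous.mul hg.continuous).integrable_of_hasCompactSupport hχc.mul_right

theorem fderiv_mul_apply {g h : Plane → ℝ} (hg : ContDiff ℝ 1 g) (hh : ContDiff ℝ 1 h)
    (q e : Plane) :
    fderiv ℝ (fun p => g p * h p) q e = g q * fderiv ℝ h q e + h q * fderiv ℝ g q e := by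
  rw [fderiv_fun_mul (hg.differentiable one_ne_zero q) (hh.differentiable one_ne_zero q)]
  simp

theorem isWeakCurl_of_contDiff {a b : Plane → ℝ} (ha : ContDiff ℝ 1 a) (hb : ContDiff ℝ 1 b)
    (U : Set Plane) :
    IsWeakCurl a b (fun q => fderiv ℝ a q (0, 1) - fderiv ℝ b q (1, 0)) U := by
  intro θ hθ hθc _
  have h1 := integral_fderiv_apply_eq_zero (hθ.mul ha) hθc.mul_right (0, 1)
  have h2 := integral_fderiv_apply_eq_zero (hθ.mul hb) hθc.mul_right (1, 0)
  have key := integral_sub (μ := volume)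
    ((continuous_fderiv_apply_const (hθ.mul ha) (0, 1)).integrable_of_hasCompactSupport
      (hasCompactSupport_fderiv_apply_const hθc.mul_right (0, 1)))
    ((continuous_fderiv_apply_const (hθ.mul hb) (1, 0)).integrable_of_hasCompactSupport
      (hasCompactSupport_fderiv_apply_const hθc.mul_right (1, 0)))
  rw [h1, h2, sub_zero] at key
  refine (integral_congr_ae (Eventually.of_forall fun q => ?_)).trans key
  simp only [fderiv_mul_apply hθ ha, fderiv_mul_apply hθ hb]
  ring

/-- Lets the form be replaced by smooth models on facets; the values on the null set of edges and
vertices are irrelevant. -/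
theorem IsWeakCurl.congr_ae {A B f A' B' f' : Plane → ℝ} {U : Set Plane}
    (h : IsWeakCurl A B f U)
    (hae : ∀ᵐ q, q ∈ U → A' q = A q ∧ B' q = B q ∧ f' q = f q) : IsWeakCurl A' B' f' U := by
  intro θ hθ hθc hθU
  refine (integral_congr_ae ?_).trans (h θ hθ hθc hθU)
  filter_upwards [hae] with q hq
  by_cases hqU : q ∈ tsupport θ
  · obtain ⟨h1, h2, h3⟩ := hq (hθU hqU)
    rw [h1, h2, h3]
  · simp [image_eq_zero_of_notMem_tsupport hqU, fderiv_apply_eq_zero_of_notMem_tsupport hqU]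

theorem IsWeakCurl.mono {A B f : Plane → ℝ} {U V : Set Plane} (h : IsWeakCurl A B f V)
    (hUV : U ⊆ V) : IsWeakCurl A B f U :=
  fun θ hθ hθc hθU => h θ hθ hθc (hθU.trans hUV)

theorem integrable_weakCurl_integrand {A B f θ : Plane → ℝ} (hA : LocallyIntegrable A)
    (hB : LocallyIntegrable B) (hf : LocallyIntegrable f) (hθ : ContDiff ℝ 1 θ)
    (hθc : HasCompactSupport θ) :
    Integrable fun q =>
      θ q * f q + fderiv ℝ θ q (0, 1) * A q - fderiv ℝ θ q (1, 0) * B q :=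
  ((hf.integrable_smul_left_of_hasCompactSupport hθ.continuous hθc).add
    (hA.integrable_smul_left_of_hasCompactSupport (continuous_fderiv_apply_const hθ _)
      (hasCompactSupport_fderiv_apply_const hθc _))).sub
    (hB.integrable_smul_left_of_hasCompactSupport (continuous_fderiv_apply_const hθ _)
      (hasCompactSupport_fderiv_apply_const hθc _))

theorem tsupport_mul_subset_of_eventuallyEq_zero {χ θ : Plane → ℝ} {U : Set Plane}
    (h : ∀ q ∈ tsupport θ \ U, χ =ᶠ[𝓝 q] 0) : tsupport (fun q => χ q * θ q) ⊆ U := by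
  intro q hq
  by_contra hqU
  exact notMem_tsupport_iff_eventuallyEq.2 (h q ⟨tsupport_mul_subset_right hq, hqU⟩)
    (tsupport_mul_subset_left hq)

/-- A test function splits as `χ θ + (1 - χ) θ`, where `χ` vanishes near the part of the support
outside `U` and equals 1 near the part outside `V`. The derivatives of `χ` cancel in the sum. -/
theorem IsWeakCurl.union {A B f : Plane → ℝ} {U V : Set Plane} (hA : LocallyIntegrable A)
    (hB : LocallyIntegrable B) (hf : LocallyIntegrable f) (hUo : IsOpen U) (hVo : IsOpen V)
    (hU : IsWeakCurl A B f U) (hV : IsWeakCurl A B f V) : IsWeakCurl A B f (U ∪ V) := by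
  intro θ hθ hθc hθUV
  obtain ⟨χ, hχ0, hχ1, -⟩ := exists_contMDiffMap_zero_one_nhds_of_isClosed
    (n := 1) (modelWithCornersSelf ℝ Plane) (s := tsupport θ \ U) (t := tsupport θ \ V)
    ((isClosed_tsupport θ).sdiff hUo) ((isClosed_tsupport θ).sdiff hVo)
    (by
      rw [Set.disjoint_left]
      rintro q ⟨hq, hqU⟩ ⟨-, hqV⟩
      exact (hθUV hq).elim hqU hqV)
  have hχ : ContDiff ℝ 1 χ := χ.contMDiff.contDiff
  have hχ' : ContDiff ℝ 1 fun q => 1 - χ q := contDiff_const.sub hχ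
  have h1 := hU _ (hχ.mul hθ) hθc.mul_left
    (tsupport_mul_subset_of_eventuallyEq_zero fun q hq => hχ0.filter_mono (nhds_le_nhdsSet hq))
  have h2 := hV _ (hχ'.mul hθ) hθc.mul_left
    (tsupport_mul_subset_of_eventuallyEq_zero fun q hq => by
      filter_upwards [hχ1.filter_mono (nhds_le_nhdsSet hq)] with p hp
      simp [hp])
  have h3 := integral_add (integrable_weakCurl_integrand hA hB hf (hχ.mul hθ) hθc.mul_left)
    (integrable_weakCurl_integrand hA hB hf (hχ'.mul hθ) hθc.mul_left)
  rw [h1, h2, add_zero] at h3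
  refine (integral_congr_ae (Eventually.of_forall fun q => ?_)).trans h3
  have h4 : ∀ e, fderiv ℝ (fun q => 1 - χ q) q e = - fderiv ℝ χ q e := fun e => by
    simp [fderiv_const_sub]
  simp only [fderiv_mul_apply hχ hθ, fderiv_mul_apply hχ' hθ, h4]
  ring

/-- The support of a test function is compact, so finitely many of the given open sets cover it and
can be merged one by one. -/
theorem isWeakCurl_of_locally {A B f : Plane → ℝ} {W : Set Plane} (hA : LocallyIntegrable A)
    (hB : LocallyIntegrable B) (hf : LocallyIntegrable f)
    (h : ∀ p ∈ W, ∃ U, IsOpen U ∧ p ∈ U ∧ IsWeakCurl A B f U) : IsWeakCurl A B f W := by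
  intro θ hθ hθc hθW
  obtain ⟨U, -, hKU, hU⟩ : ∃ U, IsOpen U ∧ tsupport θ ⊆ U ∧ IsWeakCurl A B f U := by
    refine hθc.isCompact.induction_on
      (p := fun s => ∃ U, IsOpen U ∧ s ⊆ U ∧ IsWeakCurl A B f U) ?_ ?_ ?_ ?_
    · refine ⟨∅, isOpen_empty, subset_rfl, fun θ _ _ h => ?_⟩
      have : θ = 0 := tsupport_eq_empty_iff.1 (subset_empty_iff.1 h)
      simp [this, fderiv_zero]
    · rintro s t hst ⟨U, hUo, htU, hU⟩
      exact ⟨U, hUo, hst.trans htU, hU⟩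
    · rintro s t ⟨U, hUo, hsU, hU⟩ ⟨V, hVo, htV, hV⟩
      exact ⟨U ∪ V, hUo.union hVo, union_subset_union hsU htV, hU.union hA hB hf hUo hVo hV⟩
    · intro p hp
      obtain ⟨U, hUo, hpU, hU⟩ := h p (hθW hp)
      exact ⟨U, mem_nhdsWithin_of_mem_nhds (hUo.mem_nhds hpU), U, hUo, subset_rfl, hU⟩
  exact hU θ hθ hθc hKU

/-! ### Removable singularities: level lines and points -/

/-- Such points are global extrema of the transition function, which covers the endpoints 0 and 1 as
well. -/
theorem deriv_smoothTransition_eq_zero {t : ℝ} (ht : t ≤ 0 ∨ 1 ≤ t) :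
    deriv Real.smoothTransition t = 0 := by
  rcases ht with ht | ht
  · refine IsLocalMin.deriv_eq_zero (Eventually.of_forall fun y => ?_)
    simpa [Real.smoothTransition.zero_of_nonpos ht] using Real.smoothTransition.nonneg y
  · refine IsLocalMax.deriv_eq_zero (Eventually.of_forall fun y => ?_)
    simpa [Real.smoothTransition.one_of_one_le ht] using Real.smoothTransition.le_one y

theorem exists_abs_deriv_smoothTransition_le :
    ∃ M : ℝ, ∀ t, |deriv Real.smoothTransition t| ≤ M := by
  have h : ContDiff ℝ 1 Real.smoothTransition := Real.smoothTransition.contDiff (n := 1)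
  refine (h.continuous_deriv le_rfl).bounded_above_of_compact_support
    (HasCompactSupport.intro (isCompact_Icc (a := (0 : ℝ)) (b := 1)) fun t ht => ?_)
  refine deriv_smoothTransition_eq_zero ?_
  by_contra! h
  exact ht ⟨h.1.le, h.2.le⟩

theorem exists_abs_fderiv_apply_le {g : Plane → ℝ} (hg : ContDiff ℝ 1 g)
    (hgc : HasCompactSupport g) : ∃ M : ℝ, 0 ≤ M ∧
      ∀ q, |fderiv ℝ g q (1, 0)| ≤ M ∧ |fderiv ℝ g q (0, 1)| ≤ M := by
  obtain ⟨M₁, h₁⟩ := (continuous_fderiv_apply_const hg (1, 0)).bounded_above_of_compact_support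
    (hasCompactSupport_fderiv_apply_const hgc (1, 0))
  obtain ⟨M₂, h₂⟩ := (continuous_fderiv_apply_const hg (0, 1)).bounded_above_of_compact_support
    (hasCompactSupport_fderiv_apply_const hgc (0, 1))
  exact ⟨max M₁ M₂, (norm_nonneg _).trans ((h₁ 0).trans (le_max_left _ _)),
    fun q => ⟨(h₁ q).trans (le_max_left _ _), (h₂ q).trans (le_max_right _ _)⟩⟩

/-- A `C¹` form cut off along a level line of `φ` has no singular curl there if its restriction
to the level line vanishes. -/
theorem isWeakCurl_indicator_neg {φ a b : Plane → ℝ} (hφ : ContDiff ℝ 1 φ)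
    (ha : ContDiff ℝ 1 a) (hb : ContDiff ℝ 1 b) {U : Set Plane} {C : ℝ}
    (hC0 : 0 ≤ C) (hC : ∀ q ∈ U, |fderiv ℝ φ q (0, 1) * a q - fderiv ℝ φ q (1, 0) * b q| ≤ C * |φ q|) :
    IsWeakCurl ({q | φ q < 0}.indicator a) ({q | φ q < 0}.indicator b)
      ({q | φ q < 0}.indicator fun q => fderiv ℝ a q (0, 1) - fderiv ℝ b q (1, 0)) U := by
  intro θ hθ hθc hθU
  obtain ⟨M, hM⟩ := exists_abs_deriv_smoothTransition_le
  set G : Plane → ℝ := fun q => θ q * (fderiv ℝ a q (0, 1) - fderiv ℝ b q (1, 0)) +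
    fderiv ℝ θ q (0, 1) * a q - fderiv ℝ θ q (1, 0) * b q with hG
  have hf : Continuous fun q => fderiv ℝ a q (0, 1) - fderiv ℝ b q (1, 0) :=
    (continuous_fderiv_apply_const ha _).sub (continuous_fderiv_apply_const hb _)
  have hGi : Integrable G := integrable_weakCurl_integrand ha.continuous.locallyIntegrable
    hb.continuous.locallyIntegrable hf.locallyIntegrable hθ hθc
  -- Smooth approximations of the indicator of `φ < 0`: they vanish for `φ ≥ 0` and equal 1 for `φ ≤
  -- -1 / (n + 1)`.
  have hS : ∀ n : ℕ, ContDiff ℝ 1 fun q => Real.smoothTransition (-(n + 1) * φ q) := fun n =>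
    (Real.smoothTransition.contDiff (n := 1)).comp (contDiff_const.mul hφ)
  have hS' : ∀ (n : ℕ) (q e : Plane),
      fderiv ℝ (fun q => Real.smoothTransition (-(n + 1) * φ q)) q e =
        deriv Real.smoothTransition (-(n + 1) * φ q) * (-(n + 1) * fderiv ℝ φ q e) := by
    intro n q e
    have h1 : HasDerivAt Real.smoothTransition
        (deriv Real.smoothTransition (-(n + 1) * φ q)) (-(n + 1) * φ q) :=
      ((Real.smoothTransition.contDiff (n := 1)).differentiable one_ne_zero _).hasDerivAt
    have h2 := h1.comp_hasFDerivAt q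
      (((hφ.differentiable one_ne_zero q).hasFDerivAt).const_mul (-((n : ℝ) + 1)))
    have h3 := h2.fderiv
    simp only [Function.comp_def] at h3
    rw [h3]
    simp
  -- The integrand of the smooth case for the test function "cutoff times `θ`". The first term tends
  -- to the indicator times `G`; the second, from differentiating the cutoff, lives in the strip `-1
  -- / (n + 1) < φ < 0`.
  set F : ℕ → Plane → ℝ := fun n q => Real.smoothTransition (-(n + 1) * φ q) * G q +
    θ q * (deriv Real.smoothTransition (-(n + 1) * φ q) * (-(n + 1) *
      (fderiv ℝ φ q (0, 1) * a q - fderiv ℝ φ q (1, 0) * b q))) with hF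
  have hF0 : ∀ n, ∫ q, F n q = 0 := fun n => by
    refine (integral_congr_ae (Eventually.of_forall fun q => ?_)).trans
      (isWeakCurl_of_contDiff ha hb univ _ ((hS n).mul hθ) hθc.mul_left (subset_univ _))
    simp only [fderiv_mul_apply (hS n) hθ, hS', hF, hG]
    ring
  have hlim := tendsto_integral_of_dominated_convergence (μ := volume) (F := F)
    (f := {q | φ q < 0}.indicator G) (fun q => ‖G q‖ + ‖θ q‖ * (M * C)) ?_ ?_ ?_ ?_
  · simp only [hF0] at hlim
    refine Eq.trans (integral_congr_ae (Eventually.of_forall fun q => ?_))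
      (tendsto_nhds_unique hlim tendsto_const_nhds)
    by_cases hq : φ q < 0 <;> simp [hG, indicator, hq]
  · intro n
    refine Continuous.aestronglyMeasurable ?_
    have h1 := (continuous_fderiv_apply_const hθ (0, 1))
    have h2 := (continuous_fderiv_apply_const hθ (1, 0))
    have h3 := (continuous_fderiv_apply_const hφ (0, 1))
    have h4 := (continuous_fderiv_apply_const hφ (1, 0))
    have h5 := Real.smoothTransition.continuous
    have h6 := (Real.smoothTransition.contDiff (n := 1)).continuous_deriv le_rfl
    have h7 := ha.continuous
    have h8 := hb.continuous
    have h9 := hθ.continuous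
    have h10 := hφ.continuous
    simp only [hF, hG]
    fun_prop
  · exact hGi.norm.add ((hθ.continuous.integrable_of_hasCompactSupport hθc).norm.mul_const _)
  · intro n
    refine Eventually.of_forall fun q => (norm_add_le _ _).trans (add_le_add ?_ ?_)
    · rw [norm_mul]
      refine mul_le_of_le_one_left (norm_nonneg _) ?_
      rw [Real.norm_of_nonneg (Real.smoothTransition.nonneg _)]
      exact Real.smoothTransition.le_one _
    · by_cases hq : q ∈ tsupport θ
      · rw [norm_mul]
        refine mul_le_mul_of_nonneg_left ?_ (norm_nonneg _)
        have hMn : 0 ≤ M := (abs_nonneg _).trans (hM 0)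
        have hCq := hC q (hθU hq)
        by_cases ht : -((n : ℝ) + 1) * φ q ≤ 0 ∨ 1 ≤ -((n : ℝ) + 1) * φ q
        · rw [deriv_smoothTransition_eq_zero ht, zero_mul, norm_zero]
          positivity
        · push Not at ht
          have hφn : φ q < 0 := by
            have : (0 : ℝ) < n + 1 := by positivity
            nlinarith [ht.1]
          rw [norm_mul, norm_mul]
          refine mul_le_mul (hM _) ?_ (by positivity) hMn
          rw [Real.norm_eq_abs, Real.norm_eq_abs, abs_neg, abs_of_nonneg (by positivity)]
          rw [abs_of_neg hφn] at hCq
          -- In the strip `(n + 1) |φ| < 1`, so the bound `C |φ|` absorbs the factor `n + 1` of the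
          -- cutoff derivative.
          calc ((n : ℝ) + 1) * |fderiv ℝ φ q (0, 1) * a q - fderiv ℝ φ q (1, 0) * b q|
              ≤ (n + 1) * (C * -φ q) := by gcongr
            _ = C * (-(n + 1) * φ q) := by ring
            _ ≤ C * 1 := by gcongr; exact ht.2.le
            _ = C := mul_one C
      · simp [image_eq_zero_of_notMem_tsupport hq]
  · refine Eventually.of_forall fun q => ?_
    -- Each fixed point eventually leaves the strip, so the second term tends to 0 pointwise.
    have hsecond : ∀ n : ℕ, (φ q = 0 ∨ 0 < φ q ∨ 1 ≤ -((n : ℝ) + 1) * φ q) →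
        θ q * (deriv Real.smoothTransition (-(n + 1) * φ q) * (-(n + 1) *
          (fderiv ℝ φ q (0, 1) * a q - fderiv ℝ φ q (1, 0) * b q))) = 0 := by
      intro n hn
      rw [deriv_smoothTransition_eq_zero]
      · simp
      · rcases hn with hn | hn | hn
        · simp [hn]
        · left
          have : (0 : ℝ) < n + 1 := by positivity
          nlinarith
        · exact Or.inr hn
    rcases lt_or_ge (φ q) 0 with hq | hq
    · have hev : ∀ᶠ n : ℕ in atTop, 1 ≤ -((n : ℝ) + 1) * φ q := by
        have : Tendsto (fun n : ℕ => (n : ℝ) * (-φ q)) atTop atTop :=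
          tendsto_natCast_atTop_atTop.atTop_mul_const (by linarith)
        filter_upwards [this.eventually_ge_atTop 1] with n hn
        nlinarith
      refine tendsto_const_nhds.congr' ?_
      filter_upwards [hev] with n hn
      simp only [hF]
      rw [hsecond n (Or.inr (Or.inr hn)), Real.smoothTransition.one_of_one_le hn]
      simp [indicator, hq]
    · refine tendsto_const_nhds.congr fun n => ?_
      simp only [hF]
      rw [hsecond n ((eq_or_lt_of_le hq).imp Eq.symm Or.inl),
        Real.smoothTransition.zero_of_nonpos]
      · simp [indicator, hq]
      · have : (0 : ℝ) < n + 1 := by positivity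
        nlinarith

theorem real_volume_closedBall_plane (p : Plane) {r : ℝ} (hr : 0 ≤ r) :
    volume.real (Metric.closedBall p r) = r ^ 2 * volume.real (Metric.ball (0 : Plane) 1) := by
  rw [Measure.real, Measure.addHaar_closedBall _ _ hr]
  simp [Measure.real, ENNReal.toReal_mul, hr]

/-- Isolated points are removable for bounded forms. -/
theorem IsWeakCurl.of_diff_singleton {A B f : Plane → ℝ} (hA : LocallyIntegrable A)
    (hB : LocallyIntegrable B) (hf : LocallyIntegrable f) {p : Plane} {U : Set Plane} {r C : ℝ}
    (hr : 0 < r) (hbd : ∀ᵐ q, q ∈ Metric.closedBall p r → |A q| ≤ C ∧ |B q| ≤ C)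
    (h : IsWeakCurl A B f (U \ {p})) : IsWeakCurl A B f U := by
  intro θ hθ hθc hθU
  let β : ContDiffBump (0 : Plane) := ⟨1, 2, one_pos, one_lt_two⟩
  have hβ : ContDiff ℝ 1 β := β.contDiff
  obtain ⟨M, hM0, hM⟩ := exists_abs_fderiv_apply_le hβ β.hasCompactSupport
  obtain ⟨T, hT⟩ := hθ.continuous.bounded_above_of_compact_support hθc
  have hT0 : 0 ≤ T := (norm_nonneg _).trans (hT 0)
  set G : Plane → ℝ := fun q =>
    θ q * f q + fderiv ℝ θ q (0, 1) * A q - fderiv ℝ θ q (1, 0) * B q with hG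
  have hGi : Integrable G := integrable_weakCurl_integrand hA hB hf hθ hθc
  -- Cutoffs that vanish within distance `1 / (n + 1)` of `p` and equal 1 beyond `2 / (n + 1)`.
  set χ : ℕ → Plane → ℝ := fun n q => 1 - β (((n : ℝ) + 1) • (q - p)) with hχdef
  have hχ : ∀ n, ContDiff ℝ 1 (χ n) := fun n =>
    contDiff_const.sub (hβ.comp (g := β) (f := fun q : Plane => ((n : ℝ) + 1) • (q - p)) (by fun_prop))
  have hχ' : ∀ n q e, fderiv ℝ (χ n) q e =
      -((n + 1) * fderiv ℝ β (((n : ℝ) + 1) • (q - p)) e) := by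
    intro n q e
    have h1 : HasFDerivAt (fun q : Plane => ((n : ℝ) + 1) • (q - p))
        (((n : ℝ) + 1) • ContinuousLinearMap.id ℝ Plane) q :=
      ((hasFDerivAt_id q).sub_const p).fun_const_smul _
    have h2 := ((hβ.differentiable one_ne_zero _).hasFDerivAt.comp q h1).const_sub 1
    have h3 : fderiv ℝ (χ n) q = _ := h2.fderiv
    rw [h3]
    simp
  -- The error term: the part of the equation tested with `χ n * θ` in which `χ n` is
  -- differentiated.
  set E : ℕ → Plane → ℝ := fun n q =>
    θ q * (fderiv ℝ (χ n) q (0, 1) * A q - fderiv ℝ (χ n) q (1, 0) * B q) with hE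
  have hχG : ∀ n, Integrable fun q => χ n q * G q := fun n => by
    refine hGi.bdd_mul (c := 1) (hχ n).continuous.aestronglyMeasurable
      (Eventually.of_forall fun q => ?_)
    rw [Real.norm_eq_abs, abs_le]
    constructor <;> simp only [hχdef] <;> linarith [β.nonneg (x := ((n : ℝ) + 1) • (q - p)),
      β.le_one (x := ((n : ℝ) + 1) • (q - p))]
  have hEi : ∀ n, Integrable (E n) := fun n => by
    have h1 := integrable_weakCurl_integrand hA hB hf ((hχ n).mul hθ) hθc.mul_left
    refine (h1.sub (hχG n)).congr (Eventually.of_forall fun q => ?_)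
    simp only [Pi.sub_apply, fderiv_mul_apply (hχ n) hθ, hE, hG]
    ring
  have hsum : ∀ n, ∫ q, χ n q * G q = - ∫ q, E n q := fun n => by
    rw [eq_neg_iff_add_eq_zero, ← integral_add (hχG n) (hEi n)]
    refine (integral_congr_ae (Eventually.of_forall fun q => ?_)).trans
      (h _ ((hχ n).mul hθ) hθc.mul_left (tsupport_mul_subset_of_eventuallyEq_zero ?_))
    · simp only [fderiv_mul_apply (hχ n) hθ, hE, hG]
      ring
    · rintro q ⟨hq, hqU⟩
      obtain rfl : q = p := by
        by_contra hqp
        exact hqU ⟨hθU hq, hqp⟩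
      have hc : Tendsto (fun y : Plane => ((n : ℝ) + 1) • (y - q)) (𝓝 q) (𝓝 0) := by
        have : Continuous fun y : Plane => ((n : ℝ) + 1) • (y - q) := by fun_prop
        simpa using this.tendsto q
      filter_upwards [hc (Metric.ball_mem_nhds 0 one_pos)] with y hy
      have : β (((n : ℝ) + 1) • (y - q)) = 1 :=
        β.one_of_mem_closedBall (Metric.ball_subset_closedBall hy)
      simp [hχdef, this]
  have hlim1 : Tendsto (fun n => ∫ q, χ n q * G q) atTop (𝓝 (∫ q, G q)) := by
    refine tendsto_integral_of_dominated_convergence (fun q => ‖G q‖)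
      (fun n => (hχG n).aestronglyMeasurable) hGi.norm (fun n => Eventually.of_forall fun q => ?_)
      ?_
    · rw [norm_mul]
      refine mul_le_of_le_one_left (norm_nonneg _) ?_
      rw [Real.norm_eq_abs, abs_le]
      constructor <;> simp only [hχdef] <;> linarith [β.nonneg (x := ((n : ℝ) + 1) • (q - p)),
        β.le_one (x := ((n : ℝ) + 1) • (q - p))]
    · have hne : ∀ᵐ q : Plane, q ≠ p := by simp [ae_iff]
      filter_upwards [hne] with q hq
      refine tendsto_const_nhds.congr' ?_
      have hpos : 0 < ‖q - p‖ := norm_pos_iff.2 (sub_ne_zero.2 hq)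
      have : Tendsto (fun n : ℕ => (n : ℝ) * ‖q - p‖) atTop atTop :=
        tendsto_natCast_atTop_atTop.atTop_mul_const hpos
      filter_upwards [this.eventually_ge_atTop 2] with n hn
      have : β (((n : ℝ) + 1) • (q - p)) = 0 := by
        refine β.zero_of_le_dist ?_
        rw [dist_zero_right, norm_smul, Real.norm_of_nonneg (by positivity)]
        change (2 : ℝ) ≤ _
        nlinarith
      simp [hχdef, this]
  have hlim2 : Tendsto (fun n => ∫ q, E n q) atTop (𝓝 0) := by
    -- The derivative of `χ n` is of order `n + 1` on a ball of area of order `(n + 1)⁻²`, so the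
    -- error is of order `1 / (n + 1)`. The factor 4 is the square of the outer radius of `β`.
    have hbound : ∀ᶠ n : ℕ in atTop, ‖∫ q, E n q‖ ≤
        T * (M * C + M * C) * 4 * volume.real (Metric.ball (0 : Plane) 1) * (1 / (n + 1)) := by
      have hev : ∀ᶠ n : ℕ in atTop, 2 / ((n : ℝ) + 1) ≤ r := by
        have : Tendsto (fun n : ℕ => 2 * (1 / ((n : ℝ) + 1))) atTop (𝓝 (2 * 0)) :=
          tendsto_one_div_add_atTop_nhds_zero_nat.const_mul 2
        rw [mul_zero] at this
        filter_upwards [this.eventually_le_const hr] with n hn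
        rwa [mul_one_div] at hn
      filter_upwards [hev] with n hn
      have hn0 : (0 : ℝ) < n + 1 := by positivity
      have hsupp : ∀ q, q ∉ Metric.closedBall p (2 / ((n : ℝ) + 1)) → E n q = 0 := by
        intro q hq
        have hq' : ((n : ℝ) + 1) • (q - p) ∉ tsupport β := by
          rw [β.tsupport_eq]
          intro hmem
          apply hq
          rw [mem_closedBall_zero_iff, norm_smul, Real.norm_of_nonneg hn0.le] at hmem
          rw [mem_closedBall_iff_norm, le_div_iff₀ hn0, mul_comm]
          exact hmem
        simp only [hE, hχ', fderiv_apply_eq_zero_of_notMem_tsupport hq']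
        simp
      rw [← setIntegral_eq_integral_of_forall_compl_eq_zero hsupp]
      refine (norm_setIntegral_le_of_norm_le_const_ae' (C := T * (M * C + M * C) * (n + 1))
        measure_closedBall_lt_top ?_).trans_eq ?_
      · filter_upwards [hbd] with q hq hqb
        obtain ⟨h1, h2⟩ := hq (Metric.closedBall_subset_closedBall hn hqb)
        have hC0 : 0 ≤ C := (abs_nonneg _).trans h1
        obtain ⟨h3, h4⟩ := hM (((n : ℝ) + 1) • (q - p))
        simp only [hE, hχ']
        rw [norm_mul, mul_assoc T]
        refine mul_le_mul (hT q) ?_ (norm_nonneg _) hT0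
        refine (norm_sub_le _ _).trans ?_
        simp only [norm_mul, norm_neg, Real.norm_eq_abs, abs_of_pos hn0]
        calc _ ≤ (((n : ℝ) + 1) * M) * C + (((n : ℝ) + 1) * M) * C := by gcongr
          _ = _ := by ring
      · rw [real_volume_closedBall_plane _ (by positivity)]
        field_simp
        ring
    refine squeeze_zero_norm' hbound ?_
    simpa using tendsto_one_div_add_atTop_nhds_zero_nat.const_mul
      (T * (M * C + M * C) * 4 * volume.real (Metric.ball (0 : Plane) 1))
  have := hlim2.neg
  simp only [← hsum, neg_zero] at this
  exact tendsto_nhds_unique hlim1 this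

/-! ### Mean value of a periodic curl -/

/-- Up to zeros, `G` lives on the disjoint sets `S` and `S + e`; the integral over the second is
translated back to the first. -/
theorem integral_eq_setIntegral_add_translate {G : Plane → ℝ} (hG : Integrable G) {S : Set Plane}
    (hS : MeasurableSet S) (e : Plane) (hdisj : ∀ q ∈ S, q + e ∉ S)
    (hsupp : ∀ q, q ∉ S → q - e ∉ S → G q = 0) :
    ∫ q, G q = ∫ q in S, (G q + G (q + e)) := by
  have hGe : Integrable fun q => G (q + e) := hG.comp_add_right e
  have h1 : ∫ q, S.indicator (fun q => G (q + e)) (q - e) =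
      ∫ q, S.indicator (fun q => G (q + e)) q :=
    integral_sub_right_eq_self (fun q => S.indicator (fun q => G (q + e)) q) e
  have h2 : Integrable fun q => S.indicator (fun q => G (q + e)) (q - e) :=
    (hGe.indicator hS).comp_sub_right e
  rw [integral_add hG.integrableOn hGe.integrableOn, ← integral_indicator hS,
    ← integral_indicator hS, ← h1, ← integral_add (hG.indicator hS) h2]
  refine integral_congr_ae (Eventually.of_forall fun q => ?_)
  by_cases h3 : q ∈ S
  · have h4 : q - e ∉ S := fun h4 => hdisj _ h4 (by simpa using h3)
    simp [h3, h4]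
  · by_cases h4 : q - e ∈ S
    · simp [h3, h4]
    · simp [h3, h4, hsupp q h3 h4]

/-- A smooth bump supported in `[a, a + 2 L]` whose translates by multiples of `L` add up to `1`. -/
noncomputable def periodBump (a L t : ℝ) : ℝ :=
  Real.smoothTransition ((t - a) / L) - Real.smoothTransition ((t - a) / L - 1)

theorem contDiff_periodBump (a L : ℝ) : ContDiff ℝ 1 (periodBump a L) := by
  have h : ContDiff ℝ 1 Real.smoothTransition := Real.smoothTransition.contDiff (n := 1)
  exact (h.comp ((contDiff_id.sub contDiff_const).div_const L)).sub
    (h.comp (((contDiff_id.sub contDiff_const).div_const L).sub contDiff_const))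

theorem periodBump_eq_zero {a L t : ℝ} (hL : 0 < L) (ht : t ≤ a ∨ a + 2 * L ≤ t) :
    periodBump a L t = 0 := by
  rcases ht with ht | ht
  · have h1 : (t - a) / L ≤ 0 := div_nonpos_of_nonpos_of_nonneg (by linarith) hL.le
    rw [periodBump, Real.smoothTransition.zero_of_nonpos h1,
      Real.smoothTransition.zero_of_nonpos (by linarith), sub_zero]
  · have h1 : 2 ≤ (t - a) / L := by rw [le_div_iff₀ hL]; linarith
    rw [periodBump, Real.smoothTransition.one_of_one_le (by linarith),
      Real.smoothTransition.one_of_one_le (by linarith), sub_self]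

theorem periodBump_nonneg {a L : ℝ} (t : ℝ) : 0 ≤ periodBump a L t :=
  sub_nonneg.2 (Real.smoothTransition.monotone (by linarith))

theorem periodBump_add_periodBump {a L : ℝ} (hL : 0 < L) (t : ℝ) :
    periodBump a L t + periodBump a L (t + L) =
      Real.smoothTransition ((t - a) / L + 1) - Real.smoothTransition ((t - a) / L - 1) := by
  have : (t + L - a) / L = (t - a) / L + 1 := by field_simp; ring
  rw [periodBump, periodBump, this, add_sub_cancel_right]
  ring

theorem periodBump_add_periodBump_mem_Icc {a L : ℝ} (hL : 0 < L) (t : ℝ) :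
    periodBump a L t + periodBump a L (t + L) ∈ Icc (0 : ℝ) 1 := by
  rw [periodBump_add_periodBump hL]
  have h1 := Real.smoothTransition.monotone (show (t - a) / L - 1 ≤ (t - a) / L + 1 by linarith)
  have h2 := Real.smoothTransition.le_one ((t - a) / L + 1)
  have h3 := Real.smoothTransition.nonneg ((t - a) / L - 1)
  exact ⟨by linarith, by linarith⟩

theorem periodBump_add_periodBump_eq_one {a L t : ℝ} (hL : 0 < L) (h1 : a ≤ t) (h2 : t ≤ a + L) :
    periodBump a L t + periodBump a L (t + L) = 1 := by
  have h3 : 0 ≤ (t - a) / L := div_nonneg (by linarith) hL.le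
  have h4 : (t - a) / L ≤ 1 := by rw [div_le_one hL]; linarith
  rw [periodBump_add_periodBump hL, Real.smoothTransition.one_of_one_le (by linarith),
    Real.smoothTransition.zero_of_nonpos (by linarith), sub_zero]

/-- The curl of a periodic form has mean value zero. -/
theorem setIntegral_eq_zero_of_isWeakCurl (R : UnitCell) {A B f : Plane → ℝ}
    (hA : LocallyIntegrable A) (hB : LocallyIntegrable B) (hf : LocallyIntegrable f)
    (hper : ∀ e ∈ ({(R.b₁ - R.a₁, 0), (0, R.b₂ - R.a₂)} : Set Plane),
      Function.Periodic A e ∧ Function.Periodic B e ∧ Function.Periodic f e)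
    (h : IsWeakCurl A B f univ) : ∫ q in R.toSet, f q = 0 := by
  have hL₁ : 0 < R.b₁ - R.a₁ := sub_pos.2 R.lt₁
  have hL₂ : 0 < R.b₂ - R.a₂ := sub_pos.2 R.lt₂
  set L₁ := R.b₁ - R.a₁
  set L₂ := R.b₂ - R.a₂
  set e₁ : Plane := (L₁, 0) with he₁
  set e₂ : Plane := (0, L₂) with he₂
  obtain ⟨hA₁, hB₁, hf₁⟩ := hper e₁ (by simp)
  obtain ⟨hA₂, hB₂, hf₂⟩ := hper e₂ (by simp)
  -- A test function supported on a block of two by two cells, whose four translates add up to 1 on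
  -- the base cell.
  set θ : Plane → ℝ := fun q => periodBump R.a₁ L₁ q.1 * periodBump R.a₂ L₂ q.2 with hθdef
  have hθ : ContDiff ℝ 1 θ :=
    ((contDiff_periodBump _ _).comp contDiff_fst).mul ((contDiff_periodBump _ _).comp contDiff_snd)
  have hθ0 : ∀ q : Plane, ¬ ((R.a₁ < q.1 ∧ q.1 < R.a₁ + 2 * L₁) ∧
      (R.a₂ < q.2 ∧ q.2 < R.a₂ + 2 * L₂)) → θ q = 0 := by
    intro q hq
    simp only [hθdef, mul_eq_zero]
    by_contra! hne
    apply hq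
    constructor
    · by_contra hc
      rw [not_and_or, not_lt, not_lt] at hc
      exact hne.1 (periodBump_eq_zero hL₁ hc)
    · by_contra hc
      rw [not_and_or, not_lt, not_lt] at hc
      exact hne.2 (periodBump_eq_zero hL₂ hc)
  have hK : IsCompact (Icc R.a₁ (R.a₁ + 2 * L₁) ×ˢ Icc R.a₂ (R.a₂ + 2 * L₂) : Set Plane) :=
    isCompact_Icc.prod isCompact_Icc
  have hθc : HasCompactSupport θ := HasCompactSupport.intro hK fun q hq =>
    hθ0 q fun hq' => hq ⟨⟨hq'.1.1.le, hq'.1.2.le⟩, ⟨hq'.2.1.le, hq'.2.2.le⟩⟩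
  set G : Plane → ℝ := fun q =>
    θ q * f q + fderiv ℝ θ q (0, 1) * A q - fderiv ℝ θ q (1, 0) * B q with hG
  have hGi : Integrable G := integrable_weakCurl_integrand hA hB hf hθ hθc
  have hG0 : ∀ q : Plane, ¬ ((R.a₁ < q.1 ∧ q.1 < R.a₁ + 2 * L₁) ∧
      (R.a₂ < q.2 ∧ q.2 < R.a₂ + 2 * L₂)) → G q = 0 := by
    intro q hq
    -- A zero of the nonnegative function `θ` is a minimum, so its derivative vanishes too, even on
    -- the boundary of the block.
    have hmin : IsLocalMin θ q := Eventually.of_forall fun y => by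
      rw [hθ0 q hq]
      exact mul_nonneg (periodBump_nonneg _) (periodBump_nonneg _)
    simp [hG, hθ0 q hq, hmin.fderiv_eq_zero]
  have hGt : ∀ e : Plane, Function.Periodic A e → Function.Periodic B e → Function.Periodic f e →
      ∀ q, G (q + e) = θ (q + e) * f q + fderiv ℝ (fun y => θ (y + e)) q (0, 1) * A q -
        fderiv ℝ (fun y => θ (y + e)) q (1, 0) * B q := by
    intro e h1 h2 h3 q
    simp only [hG, h1 q, h2 q, h3 q, fderiv_comp_add_right]
  have hsum : ∀ q ∈ (Ioc R.a₁ (R.a₁ + L₁) ×ˢ Ioc R.a₂ (R.a₂ + L₂) : Set Plane),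
      (G q + G (q + e₁)) + (G (q + e₂) + G (q + e₂ + e₁)) = f q := by
    rintro q ⟨hq1, hq2⟩
    set Θ : Plane → ℝ := fun y => (θ y + θ (y + e₁)) + (θ (y + e₂) + θ (y + (e₂ + e₁))) with hΘ
    have hΘ' : ∀ y, Θ y = (periodBump R.a₁ L₁ y.1 + periodBump R.a₁ L₁ (y.1 + L₁)) *
        (periodBump R.a₂ L₂ y.2 + periodBump R.a₂ L₂ (y.2 + L₂)) := fun y => by
      simp only [hΘ, hθdef, he₁, he₂, Prod.fst_add, Prod.snd_add, add_zero, zero_add]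
      ring
    have hΘ1 : Θ q = 1 := by
      rw [hΘ', periodBump_add_periodBump_eq_one hL₁ hq1.1.le hq1.2,
        periodBump_add_periodBump_eq_one hL₂ hq2.1.le hq2.2, one_mul]
    -- As `Θ ≤ 1` everywhere, a point with `Θ = 1` is a maximum and the derivative vanishes, even on
    -- the boundary of the cell.
    have hΘmax : IsLocalMax Θ q := Eventually.of_forall fun y => by
      rw [hΘ1, hΘ']
      have h1 := periodBump_add_periodBump_mem_Icc (a := R.a₁) hL₁ y.1
      have h2 := periodBump_add_periodBump_mem_Icc (a := R.a₂) hL₂ y.2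
      exact mul_le_one₀ h1.2 h2.1 h2.2
    have hd : ∀ e : Plane, DifferentiableAt ℝ (fun y => θ (y + e)) q := fun e =>
      (hθ.comp (contDiff_id.add contDiff_const)).differentiable one_ne_zero q
    have hd0 : DifferentiableAt ℝ θ q := hθ.differentiable one_ne_zero q
    have hΘd := hΘmax.fderiv_eq_zero
    rw [hΘ, fderiv_fun_add (hd0.fun_add (hd _)) ((hd _).fun_add (hd _)),
      fderiv_fun_add hd0 (hd _), fderiv_fun_add (hd _) (hd _)] at hΘd
    have hu := congrArg (fun L : Plane →L[ℝ] ℝ => L (1, 0)) hΘd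
    have hv := congrArg (fun L : Plane →L[ℝ] ℝ => L (0, 1)) hΘd
    simp only [add_apply, zero_apply] at hu hv
    rw [add_assoc q e₂ e₁, hGt e₁ hA₁ hB₁ hf₁, hGt e₂ hA₂ hB₂ hf₂,
      hGt (e₂ + e₁) (hA₂.add_period hA₁) (hB₂.add_period hB₁) (hf₂.add_period hf₁)]
    simp only [hG]
    simp only [hΘ] at hΘ1
    linear_combination f q * hΘ1 + A q * hv - B q * hu
  -- The integral over the block is folded onto the cell in two steps, first in `u` and then in `v`.
  -- Half-open intervals make the translates disjoint.
  set S₁ : Set Plane := Ioc R.a₁ (R.a₁ + L₁) ×ˢ univ with hS₁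
  set S₂ : Set Plane := univ ×ˢ Ioc R.a₂ (R.a₂ + L₂) with hS₂
  have hS₁m : MeasurableSet S₁ := measurableSet_Ioc.prod MeasurableSet.univ
  have hS₂m : MeasurableSet S₂ := MeasurableSet.univ.prod measurableSet_Ioc
  have step₁ : ∫ q, G q = ∫ q, S₁.indicator (fun q => G q + G (q + e₁)) q := by
    rw [integral_indicator hS₁m]
    refine integral_eq_setIntegral_add_translate hGi hS₁m e₁ ?_ ?_
    · rintro q ⟨hq, -⟩ ⟨hq', -⟩
      simp only [he₁, Prod.fst_add] at hq'
      linarith [hq.1, hq'.2]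
    · intro q hq hq'
      refine hG0 q fun ⟨hmem, _⟩ => ?_
      simp only [hS₁, he₁, mem_prod, mem_Ioc, mem_univ, and_true, Prod.fst_sub] at hq hq'
      by_cases hc : q.1 ≤ R.a₁ + L₁
      · exact hq ⟨hmem.1, hc⟩
      · exact hq' ⟨by linarith, by linarith [hmem.2]⟩
  have step₂ : ∫ q, S₁.indicator (fun q => G q + G (q + e₁)) q =
      ∫ q in S₂, (S₁.indicator (fun q => G q + G (q + e₁)) q +
        S₁.indicator (fun q => G q + G (q + e₁)) (q + e₂)) := by
    refine integral_eq_setIntegral_add_translate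
      ((hGi.add (hGi.comp_add_right e₁)).indicator hS₁m) hS₂m e₂ ?_ ?_
    · rintro q ⟨-, hq⟩ ⟨-, hq'⟩
      simp only [he₂, Prod.snd_add] at hq'
      linarith [hq.1, hq'.2]
    · intro q hq hq'
      have hout : ∀ y : Plane, y.2 = q.2 → G y = 0 := fun y hy => by
        refine hG0 y fun ⟨_, hmem⟩ => ?_
        rw [hy] at hmem
        simp only [hS₂, he₂, mem_prod, mem_Ioc, mem_univ, true_and, Prod.snd_sub] at hq hq'
        by_cases hc : q.2 ≤ R.a₂ + L₂
        · exact hq ⟨hmem.1, hc⟩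
        · exact hq' ⟨by linarith, by linarith [hmem.2]⟩
      have h1 : G q + G (q + e₁) = 0 := by
        rw [hout q rfl, hout (q + e₁) (by simp [he₁]), add_zero]
      by_cases hq1 : q ∈ S₁
      · exact (indicator_of_mem hq1 _).trans h1
      · rw [indicator_of_notMem hq1]
  have h0 : ∫ q, G q = 0 := h θ hθ hθc (subset_univ _)
  rw [step₁, step₂, ← integral_indicator hS₂m] at h0
  have hcell : (R.toSet : Set Plane) =ᵐ[volume]
      (Ioc R.a₁ (R.a₁ + L₁) ×ˢ Ioc R.a₂ (R.a₂ + L₂) : Set Plane) := by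
    have h1 : R.a₁ + L₁ = R.b₁ := add_sub_cancel _ _
    have h2 : R.a₂ + L₂ = R.b₂ := add_sub_cancel _ _
    rw [h1, h2]
    exact Measure.set_prod_ae_eq Ioc_ae_eq_Icc.symm Ioc_ae_eq_Icc.symm
  rw [setIntegral_congr_set hcell, ← integral_indicator (measurableSet_Ioc.prod measurableSet_Ioc),
    ← h0]
  refine integral_congr_ae (Eventually.of_forall fun q => ?_)
  by_cases hq2 : q ∈ S₂
  · have hq2' : q.2 ∈ Ioc R.a₂ (R.a₂ + L₂) := hq2.2
    by_cases hq1 : q ∈ S₁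
    · have hq1' : q.1 ∈ Ioc R.a₁ (R.a₁ + L₁) := hq1.1
      have hq12 : q + e₂ ∈ S₁ := ⟨by simpa [he₂] using hq1', mem_univ _⟩
      have := hsum q ⟨hq1', hq2'⟩
      simp only [indicator_of_mem hq2, indicator_of_mem hq1, indicator_of_mem hq12, this]
      exact indicator_of_mem (s := Ioc R.a₁ (R.a₁ + L₁) ×ˢ Ioc R.a₂ (R.a₂ + L₂)) ⟨hq1', hq2'⟩ f
    · have hq12 : q + e₂ ∉ S₁ := fun hmem => hq1 ⟨by simpa [he₂] using hmem.1, mem_univ _⟩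
      simp only [indicator_of_mem hq2, indicator_of_notMem hq1, indicator_of_notMem hq12, add_zero]
      rw [indicator_of_notMem fun hmem => hq1 ⟨hmem.1, mem_univ _⟩]
  · rw [indicator_of_notMem hq2, indicator_of_notMem fun hmem => hq2 ⟨mem_univ _, hmem.2⟩]

/-! ### Regular level lines -/

/-- A regular level line can be straightened: `(φ, ℓ)` are coordinates near `p`. -/
theorem exists_straightening {φ : Plane → ℝ} {p : Plane} {n : WithTop ℕ∞} (hn : n ≠ 0)
    (hφ : ContDiffAt ℝ n φ p) (hd : fderiv ℝ φ p ≠ 0) :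
    ∃ (ℓ : Plane →L[ℝ] ℝ) (Ψ : Plane → Plane), ContDiffAt ℝ n Ψ (φ p, ℓ p) ∧
      Ψ (φ p, ℓ p) = p ∧ (∀ᶠ q in 𝓝 p, Ψ (φ q, ℓ q) = q) ∧
      ∀ᶠ y in 𝓝 (φ p, ℓ p), φ (Ψ y) = y.1 ∧ ℓ (Ψ y) = y.2 := by
  set D := fderiv ℝ φ p with hD
  set α := D (1, 0)
  set β := D (0, 1)
  have hDapp : ∀ q : Plane, D q = α * q.1 + β * q.2 := fun q => by
    have : q = q.1 • ((1, 0) : Plane) + q.2 • ((0, 1) : Plane) := by ext <;> simp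
    conv_lhs => rw [this, map_add, map_smul, map_smul]
    simp only [smul_eq_mul, α, β]
    ring
  have hpos : 0 < α ^ 2 + β ^ 2 := by
    by_contra h
    have hα : α = 0 := by nlinarith [sq_nonneg α, sq_nonneg β]
    have hβ : β = 0 := by nlinarith [sq_nonneg α, sq_nonneg β]
    apply hd
    ext <;> simp [hDapp, hα, hβ]
  -- The differential of `φ` at `p` turned by a right angle, so that `(D, ℓ)` has determinant `α ^ 2
  -- + β ^ 2`.
  set ℓ : Plane →L[ℝ] ℝ :=
    α • ContinuousLinearMap.snd ℝ ℝ ℝ - β • ContinuousLinearMap.fst ℝ ℝ ℝ with hℓ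
  have hℓapp : ∀ q : Plane, ℓ q = α * q.2 - β * q.1 := fun q => by simp [hℓ]
  have hinj : Function.Injective (D.prod ℓ) := by
    rw [injective_iff_map_eq_zero]
    intro q hq
    have h1 : α * q.1 + β * q.2 = 0 := by
      rw [← hDapp]; exact congrArg Prod.fst hq
    have h2 : α * q.2 - β * q.1 = 0 := by
      rw [← hℓapp]; exact congrArg Prod.snd hq
    have h3 : (α ^ 2 + β ^ 2) * q.1 = 0 := by linear_combination α * h1 - β * h2
    have h4 : (α ^ 2 + β ^ 2) * q.2 = 0 := by linear_combination β * h1 + α * h2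
    ext
    · exact (mul_eq_zero.1 h3).resolve_left hpos.ne'
    · exact (mul_eq_zero.1 h4).resolve_left hpos.ne'
  let Λ : Plane ≃L[ℝ] Plane :=
    (LinearEquiv.ofInjectiveEndo (D.prod ℓ : Plane →ₗ[ℝ] Plane) hinj).toContinuousLinearEquiv
  have hΦ : ContDiffAt ℝ n (fun q => (φ q, ℓ q)) p := hφ.prodMk ℓ.contDiff.contDiffAt
  have hΦ' : HasFDerivAt (fun q => (φ q, ℓ q)) (Λ : Plane →L[ℝ] Plane) p := by
    have h1 : HasFDerivAt (fun q => (φ q, ℓ q)) (D.prod ℓ) p :=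
      ((hφ.differentiableAt hn).hasFDerivAt).prodMk ℓ.hasFDerivAt
    have h2 : (Λ : Plane →L[ℝ] Plane) = D.prod ℓ := by ext <;> rfl
    rwa [h2]
  have hstrict := hΦ.hasStrictFDerivAt' hΦ' hn
  refine ⟨ℓ, hΦ.localInverse hΦ' hn, hΦ.to_localInverse hΦ' hn,
    hΦ.localInverse_apply_image hΦ' hn, hstrict.eventually_left_inverse, ?_⟩
  filter_upwards [hstrict.eventually_right_inverse] with y hy
  exact ⟨congrArg Prod.fst hy, congrArg Prod.snd hy⟩

/-- The curve is the coordinate line `t ↦ Ψ (0, ℓ p + t)`. It is regular because `ℓ` grows along it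
at unit rate. -/
theorem exists_regular_curve_in_level {φ : Plane → ℝ} {p : Plane} {n : WithTop ℕ∞} (hn : n ≠ 0)
    (hφ : ContDiffAt ℝ n φ p) (h0 : φ p = 0) (hd : fderiv ℝ φ p ≠ 0) :
    ∃ γ : ℝ → Plane, ContDiffAt ℝ n γ 0 ∧ γ 0 = p ∧ (∀ᶠ t in 𝓝 0, φ (γ t) = 0) ∧
      deriv γ 0 ≠ 0 := by
  obtain ⟨ℓ, Ψ, hΨ, hΨp, -, hinv⟩ := exists_straightening hn hφ hd
  rw [h0] at hΨ hΨp hinv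
  have hc : ContDiff ℝ n fun t : ℝ => ((0, ℓ p + t) : Plane) :=
    contDiff_const.prodMk (contDiff_const.add contDiff_id)
  have htend : Tendsto (fun t : ℝ => ((0, ℓ p + t) : Plane)) (𝓝 0) (𝓝 (0, ℓ p)) := by
    simpa using hc.continuous.tendsto 0
  have hγ : ContDiffAt ℝ n (fun t : ℝ => Ψ (0, ℓ p + t)) 0 :=
    ContDiffAt.comp (0 : ℝ) (by simpa using hΨ) hc.contDiffAt
  have hev := htend.eventually hinv
  refine ⟨fun t => Ψ (0, ℓ p + t), hγ, by simpa using hΨp, hev.mono fun t ht => ht.1, fun hz => ?_⟩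
  have h1 := ℓ.hasFDerivAt.comp_hasDerivAt (0 : ℝ) (hγ.differentiableAt hn).hasDerivAt
  rw [hz, map_zero] at h1
  have h2 : HasDerivAt (fun t : ℝ => ℓ p + t) 1 0 := (hasDerivAt_id _).const_add _
  exact zero_ne_one (h1.unique (h2.congr_of_eventuallyEq (hev.mono fun t ht => ht.2)))

/-- Compare `q` with the point `Ψ (0, ℓ q)` of the level line, where `ψ` vanishes. Their distance is
at most `K' |φ q|` since `Ψ` is Lipschitz near `(φ p, ℓ p)`, and `ψ` is Lipschitz near `p`. -/
theorem exists_abs_le_mul_abs {φ ψ : Plane → ℝ} {p : Plane} (hφ : ContDiffAt ℝ 1 φ p)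
    (h0 : φ p = 0) (hd : fderiv ℝ φ p ≠ 0) (hψ : ContDiffAt ℝ 1 ψ p)
    (hz : ∀ᶠ q in 𝓝 p, φ q = 0 → ψ q = 0) :
    ∃ C : ℝ, 0 ≤ C ∧ ∀ᶠ q in 𝓝 p, |ψ q| ≤ C * |φ q| := by
  obtain ⟨ℓ, Ψ, hΨ, hΨp, hleft, hinv⟩ := exists_straightening one_ne_zero hφ hd
  obtain ⟨K, s, hs, hK⟩ := hψ.exists_lipschitzOnWith
  obtain ⟨K', s', hs', hK'⟩ := hΨ.exists_lipschitzOnWith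
  have h1 : Tendsto (fun q => (φ q, ℓ q)) (𝓝 p) (𝓝 (φ p, ℓ p)) :=
    hφ.continuousAt.prodMk ℓ.continuous.continuousAt
  have h2 : Tendsto (fun q => ((0, ℓ q) : Plane)) (𝓝 p) (𝓝 (φ p, ℓ p)) := by
    rw [h0]
    exact tendsto_const_nhds.prodMk_nhds ℓ.continuous.continuousAt
  have h3 : Tendsto (fun q => Ψ (0, ℓ q)) (𝓝 p) (𝓝 p) := by
    have := hΨ.continuousAt.tendsto.comp h2
    rwa [hΨp] at this
  refine ⟨K * K', by positivity, ?_⟩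
  filter_upwards [hs, h3.eventually_mem hs, h1.eventually_mem hs', h2.eventually_mem hs', hleft,
    h2.eventually hinv, h3.eventually hz] with q hq1 hq2 hq3 hq4 hq5 hq6 hq7
  have h4 := hK.dist_le_mul _ hq1 _ hq2
  have h5 := hK'.dist_le_mul _ hq3 _ hq4
  rw [hq7 hq6.1, dist_zero_right, Real.norm_eq_abs] at h4
  rw [hq5] at h5
  have h6 : dist ((φ q, ℓ q) : Plane) (0, ℓ q) = |φ q| := by
    simp [Prod.dist_eq]
  rw [h6] at h5
  calc |ψ q| ≤ K * dist q (Ψ (0, ℓ q)) := h4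
    _ ≤ K * (K' * |φ q|) := by gcongr
    _ = K * K' * |φ q| := by ring

/-- Near `p` the level line is the image under the differentiable map `Ψ` of part of a coordinate
line, a null set. -/
theorem exists_nhds_volume_level_eq_zero {φ : Plane → ℝ} {p : Plane} (hφ : ContDiffAt ℝ 1 φ p)
    (hd : fderiv ℝ φ p ≠ 0) : ∃ U ∈ 𝓝 p, volume (U ∩ {q | φ q = 0}) = 0 := by
  obtain ⟨ℓ, Ψ, hΨ, -, hleft, -⟩ := exists_straightening one_ne_zero hφ hd
  have h1 : Tendsto (fun q => (φ q, ℓ q)) (𝓝 p) (𝓝 (φ p, ℓ p)) :=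
    hφ.continuousAt.prodMk ℓ.continuous.continuousAt
  have hV : ∀ᶠ y in 𝓝 (φ p, ℓ p), DifferentiableAt ℝ Ψ y :=
    (hΨ.eventually (by simp)).mono fun y hy => hy.differentiableAt one_ne_zero
  refine ⟨_, hleft.and (h1.eventually hV), ?_⟩
  have hnull : volume ({0} ×ˢ univ ∩ {y | DifferentiableAt ℝ Ψ y} : Set Plane) = 0 := by
    refine measure_mono_null inter_subset_left ?_
    rw [Measure.volume_eq_prod, Measure.prod_prod]
    simp
  refine measure_mono_null ?_
    (addHaar_image_eq_zero_of_differentiableOn_of_addHaar_eq_zero volume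
      (fun y hy => (hy.2 : DifferentiableAt ℝ Ψ y).differentiableWithinAt) hnull)
  rintro q ⟨⟨hq1, hq2⟩, hq3 : φ q = 0⟩
  exact ⟨(φ q, ℓ q), ⟨⟨hq3, mem_univ _⟩, hq2⟩, hq1⟩

/-- Makes the local defining function of an edge global. The order `n` is finite so that smoothness
at `p` extends to a neighbourhood on which a bump can be supported. -/
theorem exists_contDiff_eventuallyEq {φ : Plane → ℝ} {p : Plane} {n : ℕ}
    (hφ : ContDiffAt ℝ n φ p) : ∃ g : Plane → ℝ, ContDiff ℝ n g ∧ g =ᶠ[𝓝 p] φ := by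
  obtain ⟨r, hr, hball⟩ := Metric.eventually_nhds_iff_ball.1 (hφ.eventually (by simp))
  let χ : ContDiffBump p := ⟨r / 4, r / 2, by positivity, by linarith⟩
  refine ⟨fun q => χ q * φ q, contDiff_iff_contDiffAt.2 fun q => ?_, ?_⟩
  · by_cases hq : q ∈ tsupport χ
    swap
    · refine (contDiffAt_const (c := (0 : ℝ))).congr_of_eventuallyEq ?_
      filter_upwards [notMem_tsupport_iff_eventuallyEq.1 hq] with y hy
      simp [hy]
    have hq' : q ∈ Metric.ball p r := by
      rw [χ.tsupport_eq] at hq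
      exact Metric.closedBall_subset_ball (by change r / 2 < r; linarith) hq
    exact χ.contDiff.contDiffAt.mul (hball q hq')
  · filter_upwards [χ.eventuallyEq_one] with q hq
    simp [hq]

/-! ### Edges, null sets and local bounds -/

namespace FacetDecomposition

theorem eventually_notMem_vertices (N : FacetDecomposition) {p : Plane} (hp : p ∉ N.vertices) :
    ∀ᶠ q in 𝓝 p, q ∉ N.vertices := by
  obtain ⟨U, hU, hfin⟩ := N.locallyFinite_vertices p
  filter_upwards [hU, hfin.isClosed.isOpen_compl.mem_nhds fun h => hp h.1] with q hqU hq hqv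
  exact hq ⟨hqv, hqU⟩

open scoped ContDiff in
-- Supplies the curves on which the admissibility condition is tested.
theorem exists_edge_curve (N : FacetDecomposition) {p : Plane} (hp : p ∈ N.edges) :
    ∃ γ : ℝ → Plane, ContDiffAt ℝ ∞ γ 0 ∧ γ 0 = p ∧ (∀ᶠ t in 𝓝 0, γ t ∈ N.edges) ∧
      deriv γ 0 ≠ 0 := by
  obtain ⟨P, -, Q, -, φ, hφ, h0, hd, hev⟩ := N.smooth_edge p hp.1 hp.2
  obtain ⟨γ, hγ, hγ0, hγφ, hγ'⟩ := exists_regular_curve_in_level (by simp) hφ h0 hd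
  have htend : Tendsto γ (𝓝 0) (𝓝 p) := hγ0 ▸ hγ.continuousAt.tendsto
  refine ⟨γ, hγ, hγ0, ?_, hγ'⟩
  filter_upwards [hγφ, htend.eventually hev,
    htend.eventually (N.eventually_notMem_vertices hp.1)] with t h1 h2 h3
  exact ⟨h3, h2.2.2 h1⟩

theorem volume_compl_sUnion_facets (N : FacetDecomposition) : volume (⋃₀ N.facets)ᶜ = 0 := by
  have hvert : volume N.vertices = 0 := measure_null_of_locally_null _ fun p _ => by
    obtain ⟨U, hU, hfin⟩ := N.locallyFinite_vertices p
    exact ⟨_, inter_mem_nhdsWithin _ hU, hfin.measure_zero _⟩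
  have hedge : volume N.edges = 0 := measure_null_of_locally_null _ fun p hp => by
    obtain ⟨P, hP, Q, hQ, φ, hφ, h0, hd, hev⟩ := N.smooth_edge p hp.1 hp.2
    obtain ⟨U, hU, hU0⟩ := exists_nhds_volume_level_eq_zero (hφ.of_le (by simp)) hd
    refine ⟨_, inter_mem_nhdsWithin _ (inter_mem hU hev), measure_mono_null ?_ hU0⟩
    rintro q ⟨hq1, hq2, hq3, hq4, -⟩
    refine ⟨hq2, ?_⟩
    rcases lt_trichotomy (φ q) 0 with h | h | h
    · exact absurd (hq3 h) (hq1.2 P hP)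
    · exact h
    · exact absurd (hq4 h) (hq1.2 Q hQ)
  refine measure_mono_null (fun p hp => ?_) (measure_union_null hvert hedge)
  by_cases hv : p ∈ N.vertices
  · exact Or.inl hv
  · exact Or.inr ⟨hv, fun P hP hpP => hp ⟨P, hP, hpP⟩⟩

/-- A small ball meets finitely many facets, which cover it up to a null set. On each of them `F`
agrees with a function continuous on the compact ball. -/
theorem exists_integrableOn_bounded_closedBall (N : FacetDecomposition) {F : Plane → ℝ}
    (hF : ∀ P ∈ N.facets, ∃ g, Continuous g ∧ EqOn F g P) (p : Plane) :
    ∃ r : ℝ, 0 < r ∧ IntegrableOn F (Metric.closedBall p r) ∧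
      ∃ C : ℝ, ∀ᵐ q, q ∈ Metric.closedBall p r → |F q| ≤ C := by
  obtain ⟨U, hU, hfin⟩ := N.locallyFinite_facets p
  obtain ⟨r, hr, hrU⟩ := Metric.nhds_basis_closedBall.mem_iff.1 hU
  set T := {P ∈ N.facets | (P ∩ U).Nonempty} with hT
  have hcov : ∀ᵐ q, q ∈ Metric.closedBall p r → ∃ P ∈ T, q ∈ P := by
    have : ∀ᵐ q, q ∈ ⋃₀ N.facets := N.volume_compl_sUnion_facets
    filter_upwards [this] with q ⟨P, hP, hqP⟩ hq
    exact ⟨P, ⟨hP, q, hqP, hrU hq⟩, hqP⟩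
  have hcpt := isCompact_closedBall p r
  refine ⟨r, hr, ?_, ?_⟩
  · have h1 : IntegrableOn F (⋃ P ∈ T, P ∩ Metric.closedBall p r) := by
      rw [integrableOn_finite_biUnion hfin]
      intro P hP
      obtain ⟨g, hg, hFg⟩ := hF P hP.1
      refine ((hg.continuousOn.integrableOn_compact hcpt).mono_set inter_subset_right).congr_fun
        (fun q hq => (hFg hq.1).symm)
        ((N.isOpen_facet P hP.1).measurableSet.inter hcpt.measurableSet)
    refine h1.mono_set_ae ?_
    filter_upwards [hcov] with q hq hqb
    obtain ⟨P, hP, hqP⟩ := hq hqb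
    exact mem_biUnion hP ⟨hqP, hqb⟩
  · have h2 : ∀ P ∈ T, ∃ C : ℝ, ∀ q ∈ P ∩ Metric.closedBall p r, |F q| ≤ C := by
      intro P hP
      obtain ⟨g, hg, hFg⟩ := hF P hP.1
      obtain ⟨C, hC⟩ := hcpt.exists_bound_of_continuousOn hg.continuousOn
      exact ⟨C, fun q hq => by rw [hFg hq.1]; exact hC q hq.2⟩
    choose! C hC using h2
    obtain ⟨M, hM⟩ := (hfin.image C).bddAbove
    refine ⟨M, ?_⟩
    filter_upwards [hcov] with q hq hqb
    obtain ⟨P, hP, hqP⟩ := hq hqb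
    exact (hC P hP q ⟨hqP, hqb⟩).trans (hM (mem_image_of_mem C hP))

theorem locallyIntegrable (N : FacetDecomposition) {F : Plane → ℝ}
    (hF : ∀ P ∈ N.facets, ∃ g, Continuous g ∧ EqOn F g P) : LocallyIntegrable F := by
  intro p
  obtain ⟨r, hr, hi, -⟩ := N.exists_integrableOn_bounded_closedBall hF p
  exact ⟨_, Metric.closedBall_mem_nhds p hr, hi⟩

end FacetDecomposition

/-! ### The form `[ω, w, dx]` and its curl -/

theorem IsWeakCurl.add {A B f A' B' f' : Plane → ℝ} {U : Set Plane} (h : IsWeakCurl A B f U)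
    (h' : IsWeakCurl A' B' f' U) (hA : LocallyIntegrable A) (hB : LocallyIntegrable B)
    (hf : LocallyIntegrable f) (hA' : LocallyIntegrable A') (hB' : LocallyIntegrable B')
    (hf' : LocallyIntegrable f') :
    IsWeakCurl (fun q => A q + A' q) (fun q => B q + B' q) (fun q => f q + f' q) U := by
  intro θ hθ hθc hθU
  have h1 := integral_add (integrable_weakCurl_integrand hA hB hf hθ hθc)
    (integrable_weakCurl_integrand hA' hB' hf' hθ hθc)
  rw [h θ hθ hθc hθU, h' θ hθ hθc hθU, add_zero] at h1
  refine (integral_congr_ae (Eventually.of_forall fun q => ?_)).trans h1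
  ring

/-- The triple product of `ω`, `w` and the derivative of `x` in the direction `e`. -/
noncomputable def tripleProduct (ω w x : Plane → Space) (e q : Plane) : ℝ :=
  ω q ⬝ᵥ (w q ⨯₃ fderiv ℝ x q e)

theorem dotProduct_crossProduct_eq (a b c : Space) : a ⬝ᵥ (b ⨯₃ c) =
    a 0 * (b 1 * c 2 - b 2 * c 1) + a 1 * (b 2 * c 0 - b 0 * c 2) +
      a 2 * (b 0 * c 1 - b 1 * c 0) := by
  simp [cross_apply, dotProduct, Fin.sum_univ_three]

theorem contDiff_dotProduct_crossProduct {a b c : Plane → Space} {n : WithTop ℕ∞}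
    (ha : ContDiff ℝ n a) (hb : ContDiff ℝ n b) (hc : ContDiff ℝ n c) :
    ContDiff ℝ n fun q => a q ⬝ᵥ (b q ⨯₃ c q) := by
  simp only [dotProduct_crossProduct_eq]
  have ha' := contDiff_pi.1 ha
  have hb' := contDiff_pi.1 hb
  have hc' := contDiff_pi.1 hc
  exact (((ha' 0).mul (((hb' 1).mul (hc' 2)).sub ((hb' 2).mul (hc' 1)))).add
    ((ha' 1).mul (((hb' 2).mul (hc' 0)).sub ((hb' 0).mul (hc' 2))))).add
    ((ha' 2).mul (((hb' 0).mul (hc' 1)).sub ((hb' 1).mul (hc' 0))))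

theorem hasDerivAt_dotProduct_crossProduct {a b c : ℝ → Space} {a' b' c' : Space} {t : ℝ}
    (ha : HasDerivAt a a' t) (hb : HasDerivAt b b' t) (hc : HasDerivAt c c' t) :
    HasDerivAt (fun s => a s ⬝ᵥ (b s ⨯₃ c s))
      (a' ⬝ᵥ (b t ⨯₃ c t) + a t ⬝ᵥ (b' ⨯₃ c t) + a t ⬝ᵥ (b t ⨯₃ c')) t := by
  simp only [dotProduct_crossProduct_eq]
  have ha' := hasDerivAt_pi.1 ha
  have hb' := hasDerivAt_pi.1 hb
  have hc' := hasDerivAt_pi.1 hc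
  have h := (((ha' 0).fun_mul (((hb' 1).fun_mul (hc' 2)).fun_sub
    ((hb' 2).fun_mul (hc' 1)))).fun_add
    ((ha' 1).fun_mul (((hb' 2).fun_mul (hc' 0)).fun_sub ((hb' 0).fun_mul (hc' 2))))).fun_add
    ((ha' 2).fun_mul (((hb' 0).fun_mul (hc' 1)).fun_sub ((hb' 1).fun_mul (hc' 0))))
  refine h.congr_deriv ?_
  ring

/-- The product rule for curves, applied along the line through `q` in direction `e`. -/
theorem fderiv_dotProduct_crossProduct {a b c : Plane → Space} (ha : ContDiff ℝ 1 a)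
    (hb : ContDiff ℝ 1 b) (hc : ContDiff ℝ 1 c) (q e : Plane) :
    fderiv ℝ (fun q => a q ⬝ᵥ (b q ⨯₃ c q)) q e = fderiv ℝ a q e ⬝ᵥ (b q ⨯₃ c q) +
      a q ⬝ᵥ (fderiv ℝ b q e ⨯₃ c q) + a q ⬝ᵥ (b q ⨯₃ fderiv ℝ c q e) := by
  have hline : ∀ {g : Plane → Space}, ContDiff ℝ 1 g →
      HasDerivAt (fun t : ℝ => g (q + t • e)) (fderiv ℝ g q e) 0 := fun hg =>
    (hg.differentiable one_ne_zero q).hasFDerivAt.hasLineDerivAt e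
  have h1 := hasDerivAt_dotProduct_crossProduct (hline ha) (hline hb) (hline hc)
  have h2 := (contDiff_dotProduct_crossProduct ha hb hc).differentiable one_ne_zero q
  have h3 := (h2.hasFDerivAt.hasLineDerivAt e).unique h1
  simpa using h3

theorem contDiff_tripleProduct {ω w x : Plane → Space} (hω : ContDiff ℝ 1 ω)
    (hw : ContDiff ℝ 1 w) (hx : ContDiff ℝ 2 x) (e : Plane) :
    ContDiff ℝ 1 (tripleProduct ω w x e) :=
  contDiff_dotProduct_crossProduct hω hw
    ((hx.fderiv_right (m := 1) (by norm_num)).clm_apply contDiff_const)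

/-- The curl of the form `[ω, w, dx]`. -/
theorem curl_tripleProduct {ω w x : Plane → Space} (hω : ContDiff ℝ 1 ω)
    (hw : ContDiff ℝ 1 w) (hx : ContDiff ℝ 2 x) (q : Plane) :
    fderiv ℝ (tripleProduct ω w x (1, 0)) q (0, 1) -
        fderiv ℝ (tripleProduct ω w x (0, 1)) q (1, 0) =
      ω q ⬝ᵥ (fderiv ℝ w q (0, 1) ⨯₃ fderiv ℝ x q (1, 0) -
          fderiv ℝ w q (1, 0) ⨯₃ fderiv ℝ x q (0, 1)) -
        w q ⬝ᵥ (fderiv ℝ ω q (0, 1) ⨯₃ fderiv ℝ x q (1, 0) -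
          fderiv ℝ ω q (1, 0) ⨯₃ fderiv ℝ x q (0, 1)) := by
  have hx' : ContDiff ℝ 1 (fderiv ℝ x) := hx.fderiv_right (m := 1) (by norm_num)
  have hz : ∀ e : Plane, ContDiff ℝ 1 fun q => fderiv ℝ x q e := fun e =>
    hx'.clm_apply contDiff_const
  have hz' : ∀ e e' : Plane, fderiv ℝ (fun q => fderiv ℝ x q e) q e' =
      fderiv ℝ (fderiv ℝ x) q e' e := fun e e' => by
    rw [fderiv_clm_apply (hx'.differentiable one_ne_zero q) (differentiableAt_const e)]
    simp
  -- Equality of mixed partials removes the second derivatives of `x` from the curl.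
  have hsymm : fderiv ℝ (fderiv ℝ x) q (0, 1) (1, 0) = fderiv ℝ (fderiv ℝ x) q (1, 0) (0, 1) :=
    (hx.contDiffAt.isSymmSndFDerivAt (by simp)) (0, 1) (1, 0)
  unfold tripleProduct
  rw [fderiv_dotProduct_crossProduct hω hw (hz _), fderiv_dotProduct_crossProduct hω hw (hz _),
    hz', hz', hsymm]
  simp only [dotProduct_sub, dotProduct_crossProduct_eq]
  ring

/-- The triple product depends on its second entry only through the product with `T`, and by
antisymmetry the same holds for the first entry. -/
theorem dotProduct_cross_eq_of_cross_eq {α α' β β' T : Space} (hα : α ⨯₃ T = α' ⨯₃ T)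
    (hβ : β ⨯₃ T = β' ⨯₃ T) : α ⬝ᵥ (β ⨯₃ T) = α' ⬝ᵥ (β' ⨯₃ T) := by
  have h : ∀ a b : Space, a ⬝ᵥ (b ⨯₃ T) = -(b ⬝ᵥ (a ⨯₃ T)) := fun a b => by
    simp only [dotProduct_crossProduct_eq]
    ring
  rw [hβ, h, hα, ← h]

theorem tripleProduct_apply_eq (ω w x : Plane → Space) (e q : Plane) : tripleProduct ω w x e q =
    e.1 * tripleProduct ω w x (1, 0) q + e.2 * tripleProduct ω w x (0, 1) q := by
  have : e = e.1 • ((1, 0) : Plane) + e.2 • ((0, 1) : Plane) := by ext <;> simp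
  conv_lhs => rw [this]
  simp only [tripleProduct, map_add, map_smul, dotProduct_add, dotProduct_smul, smul_eq_mul]

theorem lineDeriv_eq_fderiv_of_eqOn {g h : Plane → Space} {P : Set Plane} (hP : IsOpen P)
    (hh : ContDiff ℝ 1 h) (hgh : EqOn g h P) {q : Plane} (hq : q ∈ P) (e : Plane) :
    lineDeriv ℝ g q e = fderiv ℝ h q e := by
  have h1 : g =ᶠ[𝓝 q] h := hgh.eventuallyEq_of_mem (hP.mem_nhds hq)
  rw [h1.lineDeriv_eq, (hh.differentiable one_ne_zero q).lineDeriv_eq_fderiv]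

/-- The form `[ω, w, dx]`, evaluated in the direction `e`. -/
noncomputable def rotationForm (ω w x : Plane → Space) (e q : Plane) : ℝ :=
  ω q ⬝ᵥ (w q ⨯₃ lineDeriv ℝ x q e)

/-- The density by which the Darboux operator fails to be pointwise symmetric. -/
noncomputable def darbouxDefect (ω w x : Plane → Space) (q : Plane) : ℝ :=
  ω q ⬝ᵥ darboux x w q - w q ⬝ᵥ darboux x ω q

section Facet

variable {ω w x gω gw gx : Plane → Space} {P : Set Plane}

theorem rotationForm_eqOn (hP : IsOpen P) (hgx : ContDiff ℝ 2 gx) (hω : EqOn ω gω P)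
    (hw : EqOn w gw P) (hx : EqOn x gx P) (e : Plane) :
    EqOn (rotationForm ω w x e) (tripleProduct gω gw gx e) P := fun q hq => by
  rw [rotationForm, tripleProduct, hω hq, hw hq,
    lineDeriv_eq_fderiv_of_eqOn hP (hgx.of_le (by norm_num)) hx hq]

theorem darboux_eqOn (hP : IsOpen P) (hgw : ContDiff ℝ 1 gw) (hgx : ContDiff ℝ 2 gx)
    (hw : EqOn w gw P) (hx : EqOn x gx P) :
    EqOn (darboux x w) (fun q => fderiv ℝ gw q (0, 1) ⨯₃ fderiv ℝ gx q (1, 0) -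
      fderiv ℝ gw q (1, 0) ⨯₃ fderiv ℝ gx q (0, 1)) P := fun q hq => by
  have hgx' : ContDiff ℝ 1 gx := hgx.of_le (by norm_num)
  simp only [darboux, partialU, partialV, lineDeriv_eq_fderiv_of_eqOn hP hgw hw hq,
    lineDeriv_eq_fderiv_of_eqOn hP hgx' hx hq]

theorem darbouxDefect_eqOn (hP : IsOpen P) (hgω : ContDiff ℝ 1 gω) (hgw : ContDiff ℝ 1 gw)
    (hgx : ContDiff ℝ 2 gx) (hω : EqOn ω gω P) (hw : EqOn w gw P) (hx : EqOn x gx P) :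
    EqOn (darbouxDefect ω w x) (fun q => fderiv ℝ (tripleProduct gω gw gx (1, 0)) q (0, 1) -
      fderiv ℝ (tripleProduct gω gw gx (0, 1)) q (1, 0)) P := fun q hq => by
  simp only
  rw [curl_tripleProduct hgω hgw hgx, darbouxDefect, darboux_eqOn hP hgw hgx hw hx hq,
    darboux_eqOn hP hgω hgx hω hx hq, hω hq, hw hq]

end Facet

theorem continuous_dotProduct_darboux {gω gw gx : Plane → Space} (hgω : ContDiff ℝ 1 gω)
    (hgw : ContDiff ℝ 1 gw) (hgx : ContDiff ℝ 2 gx) :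
    Continuous fun q => gω q ⬝ᵥ (fderiv ℝ gw q (0, 1) ⨯₃ fderiv ℝ gx q (1, 0) -
      fderiv ℝ gw q (1, 0) ⨯₃ fderiv ℝ gx q (0, 1)) := by
  have hd : ∀ {g : Plane → Space}, ContDiff ℝ 1 g → ∀ e : Plane,
      ContDiff ℝ 0 fun q => fderiv ℝ g q e := fun hg e =>
    (hg.fderiv_right (m := 0) (by norm_num)).clm_apply contDiff_const
  have hgx' : ContDiff ℝ 1 gx := hgx.of_le (by norm_num)
  have hgω' : ContDiff ℝ 0 gω := hgω.of_le (by norm_num)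
  simp only [dotProduct_sub]
  exact (contDiff_dotProduct_crossProduct hgω' (hd hgw _) (hd hgx' _)).continuous.sub
    (contDiff_dotProduct_crossProduct hgω' (hd hgw _) (hd hgx' _)).continuous

/-! ### The weak curl equation on facets, edges and vertices -/

section Piecewise

variable {N : FacetDecomposition} {x ω w : Plane → Space}

theorem locallyIntegrable_dotProduct_darboux (hx : N.PiecewiseContDiff 2 x)
    (hω : N.PiecewiseContDiff 1 ω) (hw : N.PiecewiseContDiff 1 w) :
    LocallyIntegrable fun q => ω q ⬝ᵥ darboux x w q := by
  refine N.locallyIntegrable fun P hP => ?_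
  obtain ⟨gx, hgx, hx⟩ := hx P hP
  obtain ⟨gω, hgω, hω⟩ := hω P hP
  obtain ⟨gw, hgw, hw⟩ := hw P hP
  refine ⟨_, continuous_dotProduct_darboux hgω hgw hgx, fun q hq => ?_⟩
  simp only
  rw [darboux_eqOn (N.isOpen_facet P hP) hgw hgx hw hx hq, hω hq]

theorem rotationForm_piecewise (hx : N.PiecewiseContDiff 2 x)
    (hω : N.PiecewiseContDiff 1 ω) (hw : N.PiecewiseContDiff 1 w) (e : Plane) :
    ∀ P ∈ N.facets, ∃ g, Continuous g ∧ EqOn (rotationForm ω w x e) g P := fun P hP => by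
  obtain ⟨gx, hgx, hx⟩ := hx P hP
  obtain ⟨gω, hgω, hω⟩ := hω P hP
  obtain ⟨gw, hgw, hw⟩ := hw P hP
  exact ⟨_, (contDiff_tripleProduct hgω hgw hgx e).continuous,
    rotationForm_eqOn (N.isOpen_facet P hP) hgx hω hw hx e⟩

theorem isWeakCurl_facet (hx : N.PiecewiseContDiff 2 x) (hω : N.PiecewiseContDiff 1 ω)
    (hw : N.PiecewiseContDiff 1 w) {P : Set Plane} (hP : P ∈ N.facets) :
    IsWeakCurl (rotationForm ω w x (1, 0)) (rotationForm ω w x (0, 1))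
      (darbouxDefect ω w x) P := by
  obtain ⟨gx, hgx, hx⟩ := hx P hP
  obtain ⟨gω, hgω, hω⟩ := hω P hP
  obtain ⟨gw, hgw, hw⟩ := hw P hP
  have hPo := N.isOpen_facet P hP
  refine (isWeakCurl_of_contDiff (contDiff_tripleProduct hgω hgw hgx (1, 0))
    (contDiff_tripleProduct hgω hgw hgx (0, 1)) P).congr_ae (Eventually.of_forall fun q hq => ?_)
  exact ⟨rotationForm_eqOn hPo hgx hω hw hx _ hq, rotationForm_eqOn hPo hgx hω hw hx _ hq,
    darbouxDefect_eqOn hPo hgω hgw hgx hω hw hx hq⟩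

/-- The tangential part of `[ω, w, dx]` does not jump across an edge. -/
theorem exists_tripleProduct_tangent_eq (hxc : Continuous x) (hω : IsAdmissible N x ω)
    (hw : IsAdmissible N x w) {P Q : Set Plane} (hP : P ∈ N.facets) (hQ : Q ∈ N.facets)
    {ωP wP xP ωQ wQ xQ : Plane → Space} (hωPc : ContDiff ℝ 1 ωP) (hwPc : ContDiff ℝ 1 wP)
    (hxPc : ContDiff ℝ 2 xP) (hωQc : ContDiff ℝ 1 ωQ) (hwQc : ContDiff ℝ 1 wQ)
    (hxQc : ContDiff ℝ 2 xQ) (hωP : EqOn ω ωP P) (hwP : EqOn w wP P) (hxP : EqOn x xP P)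
    (hωQ : EqOn ω ωQ Q) (hwQ : EqOn w wQ Q) (hxQ : EqOn x xQ Q) {q : Plane} (hq : q ∈ N.edges)
    (hcl : ∀ᶠ y in 𝓝 q, y ∈ N.edges → y ∈ closure P ∧ y ∈ closure Q) :
    ∃ γ : ℝ → Plane, DifferentiableAt ℝ γ 0 ∧ γ 0 = q ∧ (∀ᶠ t in 𝓝 0, γ t ∈ N.edges) ∧
      deriv γ 0 ≠ 0 ∧
      tripleProduct ωP wP xP (deriv γ 0) q = tripleProduct ωQ wQ xQ (deriv γ 0) q := by
  obtain ⟨γ, hγ, hγ0, hγe, hγ'⟩ := N.exists_edge_curve hq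
  have hγd : DifferentiableAt ℝ γ 0 := hγ.differentiableAt (by simp)
  have htend : Tendsto γ (𝓝 0) (𝓝 q) := hγ0 ▸ hγ.continuousAt.tendsto
  refine ⟨γ, hγd, hγ0, hγe, hγ', ?_⟩
  have hqcl := hcl.self_of_nhds hq
  -- By continuity `x` agrees with its smooth extension on the closed facet, so `dx/ds` along the
  -- edge can be computed from either side.
  have hderiv : ∀ {S : Set Plane} {g : Plane → Space}, ContDiff ℝ 2 g → EqOn x g S →
      (∀ᶠ t in 𝓝 0, γ t ∈ closure S) →
      deriv (fun t => x (γ t)) 0 = fderiv ℝ g q (deriv γ 0) := by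
    intro S g hg hxg hS
    have h1 : (fun t => x (γ t)) =ᶠ[𝓝 0] fun t => g (γ t) :=
      hS.mono fun t ht => (hxg.closure hxc hg.continuous) ht
    have h2 : HasFDerivAt g (fderiv ℝ g q) (γ 0) := by
      rw [hγ0]
      exact (hg.differentiable two_ne_zero q).hasFDerivAt
    rw [h1.deriv_eq]
    exact (h2.comp_hasDerivAt (0 : ℝ) hγd.hasDerivAt).deriv
  have hclγ : ∀ᶠ t in 𝓝 0, γ t ∈ closure P ∧ γ t ∈ closure Q := by
    filter_upwards [htend.eventually hcl, hγe] with t h1 h2 using h1 h2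
  have hTP := hderiv hxPc hxP (hclγ.mono fun t ht => ht.1)
  have hTQ := hderiv hxQc hxQ (hclγ.mono fun t ht => ht.2)
  have hlim : ∀ {S : Set Plane} {f g : Plane → Space}, ContDiff ℝ 1 g → EqOn f g S →
      Tendsto f (𝓝[S] γ 0) (𝓝 (g q)) := by
    intro S f g hg hfg
    rw [hγ0]
    exact ((hg.continuous.tendsto q).mono_left nhdsWithin_le_nhds).congr'
      (hfg.symm.eventuallyEq_of_mem self_mem_nhdsWithin)
  have hjω := hω.single_valued γ 0 hγ hγe P hP Q hQ (hγ0 ▸ hqcl.1) (hγ0 ▸ hqcl.2) _ _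
    (hlim hωPc hωP) (hlim hωQc hωQ)
  have hjw := hw.single_valued γ 0 hγ hγe P hP Q hQ (hγ0 ▸ hqcl.1) (hγ0 ▸ hqcl.2) _ _
    (hlim hwPc hwP) (hlim hwQc hwQ)
  rw [tripleProduct, tripleProduct, ← hTP, ← hTQ]
  exact dotProduct_cross_eq_of_cross_eq hjω hjw

/-- Near `p` the form is the smooth form of `Q` plus the difference "`P` minus `Q`" cut off to `φ <
0`. The difference annihilates tangents of the edge, so cutting it off creates no singular curl. -/
theorem exists_isWeakCurl_of_mem_edges (hxc : Continuous x) (hx : N.PiecewiseContDiff 2 x)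
    (hω : IsAdmissible N x ω) (hw : IsAdmissible N x w) {p : Plane} (hp : p ∈ N.edges) :
    ∃ U, IsOpen U ∧ p ∈ U ∧ IsWeakCurl (rotationForm ω w x (1, 0)) (rotationForm ω w x (0, 1))
      (darbouxDefect ω w x) U := by
  obtain ⟨P, hP, Q, hQ, φ₀, hφ₀, h₀, hd₀, hev₀⟩ := N.smooth_edge p hp.1 hp.2
  obtain ⟨φ, hφ, hφφ₀⟩ := exists_contDiff_eventuallyEq (n := 2)
    (hφ₀.of_le (WithTop.coe_le_coe.2 (le_top : (2 : ℕ∞) ≤ ⊤)))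
  obtain ⟨ωP, hωPc, hωP⟩ := hω.piecewise_differentiable P hP
  obtain ⟨wP, hwPc, hwP⟩ := hw.piecewise_differentiable P hP
  obtain ⟨xP, hxPc, hxP⟩ := hx P hP
  obtain ⟨ωQ, hωQc, hωQ⟩ := hω.piecewise_differentiable Q hQ
  obtain ⟨wQ, hwQc, hwQ⟩ := hw.piecewise_differentiable Q hQ
  obtain ⟨xQ, hxQc, hxQ⟩ := hx Q hQ
  have hφ2 : ContDiff ℝ 2 φ := hφ
  have hφ1 : ContDiff ℝ 1 φ := hφ2.of_le (by norm_num)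
  have h0 : φ p = 0 := hφφ₀.self_of_nhds.trans h₀
  have hd : fderiv ℝ φ p ≠ 0 := by rwa [hφφ₀.fderiv_eq]
  have hev : ∀ᶠ q in 𝓝 p, ((φ q < 0 → q ∈ P) ∧ (0 < φ q → q ∈ Q)) ∧
      (φ q = 0 ↔ q ∈ N.edges) ∧ fderiv ℝ φ q ≠ 0 := by
    filter_upwards [hφφ₀, hev₀, N.eventually_notMem_vertices hp.1,
      (hφ1.continuous_fderiv one_ne_zero).continuousAt.eventually_ne hd] with q h1 h2 h3 h4
    rw [h1]
    refine ⟨⟨h2.1, h2.2.1⟩, ⟨fun h => ⟨h3, h2.2.2 h⟩, fun h => ?_⟩, h4⟩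
    rcases lt_trichotomy (φ₀ q) 0 with h5 | h5 | h5
    · exact absurd (h2.1 h5) (h.2 P hP)
    · exact h5
    · exact absurd (h2.2.1 h5) (h.2 Q hQ)
  -- At an edge point outside the closure of `P` (or `Q`), `φ` would have a local minimum (or
  -- maximum), against its non-zero differential.
  have hcl : ∀ᶠ q in 𝓝 p, q ∈ N.edges → q ∈ closure P ∧ q ∈ closure Q := by
    filter_upwards [hev, hev.eventually_nhds] with q h1 h2 hq
    have hφq : φ q = 0 := h1.2.1.2 hq
    constructor
    · by_contra hc
      refine h1.2.2 (IsLocalMin.fderiv_eq_zero ?_)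
      filter_upwards [h2, isClosed_closure.isOpen_compl.mem_nhds hc] with y hy hyc
      rw [hφq]
      by_contra! hneg
      exact hyc (subset_closure (hy.1.1 hneg))
    · by_contra hc
      refine h1.2.2 (IsLocalMax.fderiv_eq_zero ?_)
      filter_upwards [h2, isClosed_closure.isOpen_compl.mem_nhds hc] with y hy hyc
      rw [hφq]
      by_contra! hpos
      exact hyc (subset_closure (hy.1.2 hpos))
  set aP := tripleProduct ωP wP xP (1, 0) with haP
  set bP := tripleProduct ωP wP xP (0, 1) with hbP
  set aQ := tripleProduct ωQ wQ xQ (1, 0) with haQ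
  set bQ := tripleProduct ωQ wQ xQ (0, 1) with hbQ
  have haPc : ContDiff ℝ 1 aP := contDiff_tripleProduct hωPc hwPc hxPc _
  have hbPc : ContDiff ℝ 1 bP := contDiff_tripleProduct hωPc hwPc hxPc _
  have haQc : ContDiff ℝ 1 aQ := contDiff_tripleProduct hωQc hwQc hxQc _
  have hbQc : ContDiff ℝ 1 bQ := contDiff_tripleProduct hωQc hwQc hxQc _
  set a : Plane → ℝ := fun q => aP q - aQ q with ha
  set b : Plane → ℝ := fun q => bP q - bQ q with hb
  have hac : ContDiff ℝ 1 a := haPc.sub haQc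
  have hbc : ContDiff ℝ 1 b := hbPc.sub hbQc
  -- The jump form `a du + b dv` evaluated on `(φ_v, -φ_u)`, which is tangent to the level lines of
  -- `φ`.
  set ψ : Plane → ℝ := fun q => fderiv ℝ φ q (0, 1) * a q - fderiv ℝ φ q (1, 0) * b q with hψ
  have hψc : ContDiff ℝ 1 ψ := by
    have h1 : ContDiff ℝ 1 (fderiv ℝ φ) := hφ2.fderiv_right (m := 1) (by norm_num)
    exact ((h1.clm_apply contDiff_const).mul hac).sub ((h1.clm_apply contDiff_const).mul hbc)
  have hψ0 : ∀ᶠ q in 𝓝 p, φ q = 0 → ψ q = 0 := by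
    filter_upwards [hev, hev.eventually_nhds, hcl.eventually_nhds] with q h1 h2 h3 hφq
    obtain ⟨γ, hγd, hγ0, hγe, hγ', hjump⟩ := exists_tripleProduct_tangent_eq hxc hω hw hP hQ
      hωPc hwPc hxPc hωQc hwQc hxQc hωP hwP hxP hωQ hwQ hxQ (h1.2.1.1 hφq) h3
    set τ := deriv γ 0
    have htend : Tendsto γ (𝓝 0) (𝓝 q) := hγ0 ▸ hγd.continuousAt.tendsto
    have hφγ : (fun t => φ (γ t)) =ᶠ[𝓝 0] fun _ => 0 := by
      filter_upwards [htend.eventually h2, hγe] with t h4 h5 using h4.2.1.2 h5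
    have hτφ : fderiv ℝ φ q τ = 0 := by
      have h4 : HasFDerivAt φ (fderiv ℝ φ q) (γ 0) := by
        rw [hγ0]
        exact (hφ1.differentiable one_ne_zero q).hasFDerivAt
      have h5 := (h4.comp_hasDerivAt (0 : ℝ) hγd.hasDerivAt)
      exact h5.unique ((hasDerivAt_const (0 : ℝ) (0 : ℝ)).congr_of_eventuallyEq hφγ)
    have hτ1 : τ.1 * fderiv ℝ φ q (1, 0) + τ.2 * fderiv ℝ φ q (0, 1) = 0 := by
      have : τ = τ.1 • ((1, 0) : Plane) + τ.2 • ((0, 1) : Plane) := by ext <;> simp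
      rw [this, map_add, map_smul, map_smul] at hτφ
      exact hτφ
    have hτ2 : τ.1 * a q + τ.2 * b q = 0 := by
      rw [tripleProduct_apply_eq, tripleProduct_apply_eq ωQ] at hjump
      simp only [ha, hb, haP, hbP, haQ, hbQ]
      linear_combination hjump
    -- The non-zero vector `τ` solves two linear equations with rows `(φ_u, φ_v)` and `(a, b)`; up
    -- to sign `ψ` is their determinant, so it vanishes.
    have h4 : τ.1 * ψ q = 0 := by
      simp only [hψ]
      linear_combination fderiv ℝ φ q (0, 1) * hτ2 - b q * hτ1
    have h5 : τ.2 * ψ q = 0 := by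
      simp only [hψ]
      linear_combination a q * hτ1 - fderiv ℝ φ q (1, 0) * hτ2
    by_contra hne
    exact hγ' (Prod.ext ((mul_eq_zero.1 h4).resolve_right hne)
      ((mul_eq_zero.1 h5).resolve_right hne))
  obtain ⟨C, hC0, hC⟩ := exists_abs_le_mul_abs hφ1.contDiffAt h0 hd hψc.contDiffAt hψ0
  obtain ⟨V, hV, hV0⟩ := exists_nhds_volume_level_eq_zero hφ1.contDiffAt hd
  obtain ⟨U, hU, hUo, hpU⟩ := eventually_nhds_iff.1 ((hev.and hC).and hV)
  refine ⟨U, hUo, hpU, ?_⟩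
  have hS : MeasurableSet {q | φ q < 0} := (isOpen_lt hφ1.continuous continuous_const).measurableSet
  have hcurl : ∀ {a b : Plane → ℝ}, ContDiff ℝ 1 a → ContDiff ℝ 1 b →
      LocallyIntegrable fun q => fderiv ℝ a q (0, 1) - fderiv ℝ b q (1, 0) := fun ha hb =>
    ((continuous_fderiv_apply_const ha _).sub
      (continuous_fderiv_apply_const hb _)).locallyIntegrable
  refine ((isWeakCurl_indicator_neg hφ1 hac hbc hC0 fun q hq => (hU q hq).1.2).add
    (isWeakCurl_of_contDiff haQc hbQc U) (hac.continuous.locallyIntegrable.indicator hS)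
    (hbc.continuous.locallyIntegrable.indicator hS) ((hcurl hac hbc).indicator hS)
    haQc.continuous.locallyIntegrable hbQc.continuous.locallyIntegrable
    (hcurl haQc hbQc)).congr_ae ?_
  have hVae : ∀ᵐ q, q ∉ V ∩ {q | φ q = 0} := measure_eq_zero_iff_ae_notMem.1 hV0
  filter_upwards [hVae] with q hqV hqU
  obtain ⟨⟨⟨⟨h1, h2⟩, -⟩, -⟩, hqV'⟩ := hU q hqU
  have hPo := N.isOpen_facet P hP
  have hQo := N.isOpen_facet Q hQ
  rcases lt_or_gt_of_ne fun h => hqV ⟨hqV', h⟩ with h | h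
  · have hfa : ∀ e, fderiv ℝ a q e = fderiv ℝ aP q e - fderiv ℝ aQ q e := fun e => by
      rw [ha, fderiv_fun_sub (haPc.differentiable one_ne_zero q)
        (haQc.differentiable one_ne_zero q)]
      rfl
    have hfb : ∀ e, fderiv ℝ b q e = fderiv ℝ bP q e - fderiv ℝ bQ q e := fun e => by
      rw [hb, fderiv_fun_sub (hbPc.differentiable one_ne_zero q)
        (hbQc.differentiable one_ne_zero q)]
      rfl
    have hmem : q ∈ {q | φ q < 0} := h
    simp only [indicator_of_mem hmem, hfa, hfb]
    rw [rotationForm_eqOn hPo hxPc hωP hwP hxP _ (h1 h),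
      rotationForm_eqOn hPo hxPc hωP hwP hxP _ (h1 h),
      darbouxDefect_eqOn hPo hωPc hwPc hxPc hωP hwP hxP (h1 h)]
    refine ⟨?_, ?_, ?_⟩ <;> simp only [ha, hb] <;> ring
  · have hmem : q ∉ {q | φ q < 0} := not_lt_of_gt h
    simp only [indicator_of_notMem hmem, zero_add]
    exact ⟨rotationForm_eqOn hQo hxQc hωQ hwQ hxQ _ (h2 h),
      rotationForm_eqOn hQo hxQc hωQ hwQ hxQ _ (h2 h),
      darbouxDefect_eqOn hQo hωQc hwQc hxQc hωQ hwQ hxQ (h2 h)⟩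

/-- The defect of symmetry is the curl of `[ω, w, dx]` on the whole plane: neither the edges nor
the vertices contribute. -/
theorem isWeakCurl_rotationForm (hxc : Continuous x) (hx : N.PiecewiseContDiff 2 x)
    (hω : IsAdmissible N x ω) (hw : IsAdmissible N x w) :
    IsWeakCurl (rotationForm ω w x (1, 0)) (rotationForm ω w x (0, 1))
      (darbouxDefect ω w x) univ := by
  have hω1 := hω.piecewise_differentiable
  have hw1 := hw.piecewise_differentiable
  have hA := N.locallyIntegrable (rotationForm_piecewise hx hω1 hw1 (1, 0))
  have hB := N.locallyIntegrable (rotationForm_piecewise hx hω1 hw1 (0, 1))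
  have hf : LocallyIntegrable (darbouxDefect ω w x) :=
    (locallyIntegrable_dotProduct_darboux hx hω1 hw1).sub
      (locallyIntegrable_dotProduct_darboux hx hw1 hω1)
  have hoff : IsWeakCurl (rotationForm ω w x (1, 0)) (rotationForm ω w x (0, 1))
      (darbouxDefect ω w x) N.verticesᶜ := by
    refine isWeakCurl_of_locally hA hB hf fun p hp => ?_
    by_cases hpP : ∃ P ∈ N.facets, p ∈ P
    · obtain ⟨P, hP, hpP⟩ := hpP
      exact ⟨P, N.isOpen_facet P hP, hpP, isWeakCurl_facet hx hω1 hw1 hP⟩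
    · push Not at hpP
      exact exists_isWeakCurl_of_mem_edges hxc hx hω hw ⟨hp, hpP⟩
  refine isWeakCurl_of_locally hA hB hf fun p _ => ?_
  obtain ⟨V, hV, hfin⟩ := N.locallyFinite_vertices p
  obtain ⟨r₁, hr₁, -, C₁, hC₁⟩ :=
    N.exists_integrableOn_bounded_closedBall (rotationForm_piecewise hx hω1 hw1 (1, 0)) p
  obtain ⟨r₂, hr₂, -, C₂, hC₂⟩ :=
    N.exists_integrableOn_bounded_closedBall (rotationForm_piecewise hx hω1 hw1 (0, 1)) p
  -- Deleting the finitely many other vertices leaves a neighbourhood in which at most `p` itself is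
  -- a vertex.
  have hfin' : ((N.vertices ∩ V) \ {p}).Finite := hfin.subset sdiff_subset
  refine ⟨interior V \ ((N.vertices ∩ V) \ {p}), isOpen_interior.sdiff hfin'.isClosed,
    ⟨mem_interior_iff_mem_nhds.2 hV, fun h => h.2 rfl⟩,
    IsWeakCurl.of_diff_singleton (p := p) (r := min r₁ r₂) (C := max C₁ C₂) hA hB hf (lt_min hr₁ hr₂) ?_
      (hoff.mono ?_)⟩
  · filter_upwards [hC₁, hC₂] with q h1 h2 hq
    exact ⟨(h1 (Metric.closedBall_subset_closedBall (min_le_left _ _) hq)).trans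
        (le_max_left _ _),
      (h2 (Metric.closedBall_subset_closedBall (min_le_right _ _) hq)).trans (le_max_right _ _)⟩
  · rintro q ⟨⟨hq1, hq2⟩, hq3⟩ hqv
    exact hq2 ⟨⟨hqv, interior_subset hq1⟩, hq3⟩

end Piecewise

/-! ### Periodicity and conclusion -/

/-- The surface `x` is periodic only up to additive constants, but differentiation removes these. -/
theorem lineDeriv_periodic_of_add {g : Plane → Space} {c : Space} {e : Plane}
    (h : ∀ q, g (q + e) = g q + c) (d : Plane) : Function.Periodic (fun q => lineDeriv ℝ g q d) e := by
  intro q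
  have h1 : (fun t : ℝ => g (q + e + t • d)) = fun t => g (q + t • d) + c := by
    funext t
    rw [add_right_comm, h]
  simp only [lineDeriv, h1, deriv_add_const]

theorem darboux_periodic {x w : Plane → Space} {c : Space} {e : Plane}
    (hx : ∀ q, x (q + e) = x q + c) (hw : Function.Periodic w e) :
    Function.Periodic (darboux x w) e := by
  intro q
  have h1 := fun d => lineDeriv_periodic_of_add hx d q
  have h2 := fun d => lineDeriv_periodic_of_add (g := w) (e := e) (c := 0)
    (fun q => by rw [hw q, add_zero]) d q
  simp only at h1 h2
  simp only [darboux, partialU, partialV, h1, h2]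

end PeriodicShell

theorem mainTheorem3 (R : PeriodicShell.UnitCell) (N : PeriodicShell.FacetDecomposition)
    (x ω w : PeriodicShell.Plane → PeriodicShell.Space)
    (hx : PeriodicShell.IsPeriodicSurface R N x)
    (hω : PeriodicShell.IsAdmissible N x ω) (hω_per : R.IsPeriodic ω)
    (hw : PeriodicShell.IsAdmissible N x w) (hw_per : R.IsPeriodic w) :
    IntegrableOn (fun p => ω p ⬝ᵥ PeriodicShell.darboux x w p) R.toSet ∧
    IntegrableOn (fun p => w p ⬝ᵥ PeriodicShell.darboux x ω p) R.toSet ∧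
    (⨍ p in R.toSet, ω p ⬝ᵥ PeriodicShell.darboux x w p) =
      (⨍ p in R.toSet, w p ⬝ᵥ PeriodicShell.darboux x ω p) := by
  have hx2 : N.PiecewiseContDiff 2 x := fun P hP => by
    obtain ⟨g, hg, hxg⟩ := hx.isSurface.piecewise_smooth P hP
    exact ⟨g, hg.of_le (WithTop.coe_le_coe.2 (le_top : (2 : ℕ∞) ≤ ⊤)), hxg⟩
  have hω1 := hω.piecewise_differentiable
  have hw1 := hw.piecewise_differentiable
  have h1 := PeriodicShell.locallyIntegrable_dotProduct_darboux hx2 hω1 hw1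
  have h2 := PeriodicShell.locallyIntegrable_dotProduct_darboux hx2 hw1 hω1
  have hK : IsCompact R.toSet := isCompact_Icc.prod isCompact_Icc
  have hi1 := h1.integrableOn_isCompact hK
  have hi2 := h2.integrableOn_isCompact hK
  refine ⟨hi1, hi2, ?_⟩
  have hper : ∀ e ∈ ({(R.b₁ - R.a₁, 0), (0, R.b₂ - R.a₂)} : Set PeriodicShell.Plane),
      (∃ c, ∀ q, x (q + e) = x q + c) ∧ Function.Periodic ω e ∧ Function.Periodic w e := by
    obtain ⟨p₁, p₂, y, -, hy, hxy⟩ := hx.periodic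
    rintro e (rfl | rfl)
    · refine ⟨⟨(R.b₁ - R.a₁) • p₁, fun q => ?_⟩, hω_per.1, hw_per.1⟩
      rw [hxy, hxy, hy.1 q]
      simp only [Prod.fst_add, Prod.snd_add, add_zero]
      module
    · refine ⟨⟨(R.b₂ - R.a₂) • p₂, fun q => ?_⟩, hω_per.2, hw_per.2⟩
      rw [hxy, hxy, hy.2 q]
      simp only [Prod.fst_add, Prod.snd_add, add_zero]
      module
  -- The form and its curl involve `x` only through derivatives, hence are periodic, and the
  -- difference of the two integrands integrates to zero.
  have h0 := PeriodicShell.setIntegral_eq_zero_of_isWeakCurl R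
    (N.locallyIntegrable (PeriodicShell.rotationForm_piecewise hx2 hω1 hw1 (1, 0)))
    (N.locallyIntegrable (PeriodicShell.rotationForm_piecewise hx2 hω1 hw1 (0, 1))) (h1.sub h2)
    (fun e he => by
      obtain ⟨⟨c, hc⟩, hωe, hwe⟩ := hper e he
      have hform : ∀ d, Function.Periodic (PeriodicShell.rotationForm ω w x d) e := fun d q => by
        have := PeriodicShell.lineDeriv_periodic_of_add hc d q
        simp only at this
        simp only [PeriodicShell.rotationForm, hωe q, hwe q, this]
      refine ⟨hform _, hform _, fun q => ?_⟩
      simp only [Pi.sub_apply, hωe q, hwe q, PeriodicShell.darboux_periodic hc hωe q,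
        PeriodicShell.darboux_periodic hc hwe q])
    (PeriodicShell.isWeakCurl_rotationForm hx.isSurface.continuous hx2 hω hw)
  have h3 := integral_sub hi1 hi2
  simp only [Pi.sub_apply] at h0
  rw [h0] at h3
  rw [setAverage_eq, setAverage_eq, sub_eq_zero.1 h3.symm]
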